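/- **Consistency of $\mathrm{LD}^{\mu\nabla}$.** *Syntax.* Fix base types; first-order types are generated from them by $\to$. A signature $\Sigma$ consists of constants $\kappa:\tau$ of first-order type and predicate constants $p:\tau_1\to\dots\to\tau_n\to o$ with all $\tau_i$ first-order. There are countably many nominal constants $n^\tau_0,n^\tau_1,\dots$ in each first-order type $\tau$. Terms are simply typed $\lambda$-terms over the constants, the nominal constants and a finite context $\mathcal X$ of typed variables, modulo $\alpha\beta\eta$. Formulas over $\mathcal X$ are built from $\bot,\top$, atoms $p\,\vec t$, $\wedge,\vee,\supset$ and $\forall_\alpha,\exists_\alpha,\nabla_\alpha$ ($\alpha$ first-order). $\mathrm{supp}$ denotes the set of nominal constants appearing in a term, formula or substitution (modulo $\alpha\beta\eta$). A term is ground if it has no free variables. A substitution $\theta:\mathcal Y\to\mathcal X$ assigns to each variable of $\mathcal X$ a term over $\mathcal Y$ of the same type. Sequents $\mathcal X;\Gamma\vdash C$ have a finite multiset $\Gamma$ of formulas and a formula $C$, all over $\mathcal X$. *Definitions.* $\mathcal D$ is a set of clauses $H\stackrel{\Delta}{=}_{\mathcal X}B$, where $H=p\,\vec t$ is an atom and $B$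 a formula, both over $\mathcal X$ and with empty support, every variable of $\mathcal X$ appears in $H$, and $H$ lies in the $L_\lambda$ pattern fragment (free variables are applied only to distinct bound variables). $\mathcal I$ is a set of clauses $p\,\vec x\stackrel{\mu}{=}_{\vec x}B\,p\,\vec x$, at most one for each $p$, where $B$ is closed (it contains neither free variables nor nominal constants) and does not contain $p$, and $p$ is not the head of a clause of $\mathcal D$. *Stratification.* A level assignment gives each ground atom an ordinal and extends to ground formulas by $\mathrm{lvl}(\bot)=\mathrm{lvl}(\top)=0$; $\mathrm{lvl}(A\wedge B)=\mathrm{lvl}(A\vee B)=\max(\mathrm{lvl}A,\mathrm{lvl}B)$; $\mathrm{lvl}(A\supset B)=\max(\mathrm{lvl}A+1,\mathrm{lvl}B)$; $\mathrm{lvl}(\forall_\alpha x.C)=\mathrm{lvl}(\exists_\alpha x.C)=\sup\{\mathrm{lvl}(C[t/x]) : t \text{ ground of type }\alpha\}$; $\mathrm{lvl}(\nabla_\alpha x.C)=\mathrm{lvl}(C[n/x])$ for every nominal constant $n:\alpha$, $n\notin\mathrm{supp}(C)$. $\mathcal D$ is weakly stratified if $\mathrm{lvl}(H\rho)\ge\mathrm{lvl}(B\rho)$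 for each clause and each grounding substitution $\rho$. $\mathcal I$ is strictly stratified if $\mathrm{lvl}(p\,\vec t)\ge\mathrm{lvl}(B\,p\,\vec t)$ for each clause and all ground $\vec t$, and moreover $\mathrm{lvl}(p\,\vec t)$ does not depend on $\vec t$. Both conditions refer to the same level assignment. *Rules.* Write $\mathrm{defn}(H\stackrel{\Delta}{=}_{\mathcal X}B,A,\theta,B')$, for $A$ over $\mathcal Y$ and $\theta:\mathcal Z\to\mathcal Y$, if $\mathrm{supp}(\theta)=\emptyset$ and there is $\rho:\mathcal Z\to\mathcal X$ with $H\rho=A\theta$ and $B'=B\rho$. Derivability in $\mathrm{LD}^{\mu\nabla}(\mathcal D,\mathcal I)$ is generated by: - the usual intuitionistic left and right rules for $\bot,\top,\wedge,\vee,\supset$, left contraction and weakening, and $\forall\mathcal L$, $\exists\mathcal R$ with instances $C[t/x]$, $t$ any term over $\mathcal X$; - $\forall\mathcal R$: from $\mathcal X,y;\Gamma\vdash C[y\,\vec n/x]$ infer $\mathcal X;\Gamma\vdash\forall x.C$, and $\exists\mathcal L$: from $\mathcal X,y;\Gamma,C[y\,\vec n/x]\vdash D$ infer $\mathcal X;\Gamma,\exists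 x.C\vdash D$, where $\vec n$ enumerates $\mathrm{supp}(C)$ and $y\notin\mathcal X$; - $\nabla\mathcal R$: from $\mathcal X;\Gamma\vdash C[n/x]$ infer $\mathcal X;\Gamma\vdash\nabla x.C$, and $\nabla\mathcal L$: from $\mathcal X;\Gamma,C[n/x]\vdash D$ infer $\mathcal X;\Gamma,\nabla x.C\vdash D$, where $n\notin\mathrm{supp}(C)$; - axiom: $\mathcal X;A\vdash A[\pi]$ for $A$ atomic and $\pi$ a type-preserving permutation of $\mathrm{supp}(A)$; - multicut: from $\mathcal X;\Delta_i\vdash A_i$ ($1\le i\le n$, $n\ge0$) and $\mathcal X;\Gamma,A_1,\dots,A_n\vdash C$ infer $\mathcal X;\Gamma,\Delta_1,\dots,\Delta_n\vdash C$; - $\Delta\mathcal L$, for an atom $A$ whose predicate has no clause in $\mathcal I$: infer $\mathcal Y;\Gamma,A\vdash C$ from all $\mathcal Z;\Gamma\theta,B'\vdash C\theta$ such that $\mathrm{defn}(H\stackrel{\Delta}{=}_{\mathcal X}B,A,\theta,B')$ for a clause of $\mathcal D$ and $\mathcal Z$ consists of the variables appearing in $\theta$; $\Delta\mathcal R$: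 from $\mathcal Y;\Gamma\vdash B'$ infer $\mathcal Y;\Gamma\vdash A$ if $\mathrm{defn}(H\stackrel{\Delta}{=}_{\mathcal X}B,A,\epsilon_{\mathcal Y},B')$ for a clause of $\mathcal D$, $\epsilon_{\mathcal Y}$ being the identity substitution; - for $p\,\vec x\stackrel{\mu}{=}_{\vec x}B\,p\,\vec x$ in $\mathcal I$: $\mu\mathcal R$: from $\mathcal X;\Gamma\vdash B\,p\,\vec t$ infer $\mathcal X;\Gamma\vdash p\,\vec t$; $\mu\mathcal L$: from $\vec x;B\,S\,\vec x\vdash S\,\vec x$ and $\mathcal X;\Gamma,S\,\vec t\vdash C$ infer $\mathcal X;\Gamma,p\,\vec t\vdash C$, where the invariant $S$ is a term of the type of $p$ containing neither free variables nor nominal constants. **Corollary.** If, for one level assignment, $\mathcal D$ is weakly stratified and $\mathcal I$ is strictly stratified, then $\mathrm{LD}^{\mu\nabla}(\mathcal D,\mathcal I)$ is consistent: the sequent $\emptyset;\vdash\bot$ is not derivable. -/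

import Mathlib

universe u v

namespace LD

/-! ## Types, signatures, variables -/

/-- First-order types (types not containing `o`): simple types over the base types. -/
inductive Ty (B : Type u) : Type u
  | base (b : B) : Ty B
  | arr (α β : Ty B) : Ty B

/-- A signature: base types, typed constants `κ : τ` of first-order type, and predicate constants
`p : τ₁ → ⋯ → τₙ → o`, where `arity p = [τ₁, …, τₙ]` is a list of first-order types.
The logical constants are constructors of `Form` below. -/
structure Signature where
  Base : Type u
  Const : Ty Base → Type u
  Pred : Type u
  arity : Pred → List (Ty Base)

/-- Variable contexts: finite lists of first-order types (de Bruijn indices for variables). -/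
abbrev Ctx (S : Signature.{u}) : Type u := List (Ty S.Base)

/-- `Var Γ τ`: the variables of type `τ` in the context `Γ`. -/
inductive Var {B : Type u} : List (Ty B) → Ty B → Type u
  | zero {Γ : List (Ty B)} {τ : Ty B} : Var (τ :: Γ) τ
  | succ {Γ : List (Ty B)} {τ σ : Ty B} (x : Var Γ τ) : Var (σ :: Γ) τ

/-- Nominal constants: countably many at each first-order type. `(τ, k)` is `n_k : τ`. -/
abbrev Nominal (S : Signature.{u}) : Type u := Ty S.Base × ℕ

/-- Type-preserving permutations of the nominal constants. -/
abbrev NomPerm (S : Signature.{u}) : Type u := Ty S.Base → Equiv.Perm ℕ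

/-! ## Simply typed lambda terms, and `βη`-conversion -/

/-- Well-typed lambda terms (de Bruijn), before taking the quotient by `βη`-conversion. -/
inductive Raw (S : Signature.{u}) : Ctx S → Ty S.Base → Type u
  | var {Γ : Ctx S} {τ : Ty S.Base} (x : Var Γ τ) : Raw S Γ τ
  | const {Γ : Ctx S} {τ : Ty S.Base} (c : S.Const τ) : Raw S Γ τ
  | nom {Γ : Ctx S} (τ : Ty S.Base) (k : ℕ) : Raw S Γ τ
  | app {Γ : Ctx S} {α β : Ty S.Base} (t : Raw S Γ (Ty.arr α β)) (s : Raw S Γ α) : Raw S Γ β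
  | lam {Γ : Ctx S} {α β : Ty S.Base} (t : Raw S (α :: Γ) β) : Raw S Γ (Ty.arr α β)

section RawTerms

variable {S : Signature.{u}}

/-- Renamings of variables. -/
abbrev Ren (Γ Δ : Ctx S) : Type u := ∀ τ : Ty S.Base, Var Γ τ → Var Δ τ

/-- Raw simultaneous substitutions: a term over `Δ` for each variable of `Γ`. -/
abbrev RawSub (Γ Δ : Ctx S) : Type u := ∀ τ : Ty S.Base, Var Γ τ → Raw S Δ τ

def Ren.lift {Γ Δ : Ctx S} (ρ : Ren Γ Δ) (α : Ty S.Base) : Ren (α :: Γ) (α :: Δ)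
  | _, Var.zero => Var.zero
  | _, Var.succ x => Var.succ (ρ _ x)

def Raw.rename : {Γ : Ctx S} → {τ : Ty S.Base} → Raw S Γ τ → {Δ : Ctx S} → Ren Γ Δ → Raw S Δ τ
  | _, _, .var x, _, ρ => .var (ρ _ x)
  | _, _, .const c, _, _ => .const c
  | _, _, .nom τ k, _, _ => .nom τ k
  | _, _, .app t s, _, ρ => .app (t.rename ρ) (s.rename ρ)
  | _, _, .lam t, _, ρ => .lam (t.rename (ρ.lift _))

/-- The weakening renaming. -/
def Ren.wk {Γ : Ctx S} (α : Ty S.Base) : Ren Γ (α :: Γ) := fun _ x => Var.succ x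

def RawSub.lift {Γ Δ : Ctx S} (σ : RawSub Γ Δ) (α : Ty S.Base) : RawSub (α :: Γ) (α :: Δ)
  | _, Var.zero => .var Var.zero
  | _, Var.succ x => (σ _ x).rename (Ren.wk α)

/-- Capture-avoiding simultaneous substitution. -/
def Raw.subst : {Γ : Ctx S} → {τ : Ty S.Base} → Raw S Γ τ → {Δ : Ctx S} → RawSub Γ Δ → Raw S Δ τ
  | _, _, .var x, _, σ => σ _ x
  | _, _, .const c, _, _ => .const c
  | _, _, .nom τ k, _, _ => .nom τ k
  | _, _, .app t s, _, σ => .app (t.subst σ) (s.subst σ)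
  | _, _, .lam t, _, σ => .lam (t.subst (σ.lift _))

/-- The substitution of `s` for the most recent variable. -/
def RawSub.inst {Γ : Ctx S} {α : Ty S.Base} (s : Raw S Γ α) : RawSub (α :: Γ) Γ
  | _, Var.zero => s
  | _, Var.succ x => .var x

/-- Renaming the nominal constants. -/
def Raw.perm (π : NomPerm S) : {Γ : Ctx S} → {τ : Ty S.Base} → Raw S Γ τ → Raw S Γ τ
  | _, _, .var x => .var x
  | _, _, .const c => .const c
  | _, _, .nom τ k => .nom τ (π τ k)
  | _, _, .app t s => .app (t.perm π) (s.perm π)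
  | _, _, .lam t => .lam (t.perm π)

/-- The nominal constants occurring in a raw term. -/
def Raw.noms : {Γ : Ctx S} → {τ : Ty S.Base} → Raw S Γ τ → Set (Nominal S)
  | _, _, .var _ => ∅
  | _, _, .const _ => ∅
  | _, _, .nom τ k => {(τ, k)}
  | _, _, .app t s => t.noms ∪ s.noms
  | _, _, .lam t => t.noms

/-- `t.Occurs x`: the variable `x` occurs free in the raw term `t`. -/
def Raw.Occurs : {Γ : Ctx S} → {τ : Ty S.Base} → Raw S Γ τ → {σ : Ty S.Base} → Var Γ σ → Prop
  | Γ, _, .var y, _, x => (⟨_, x⟩ : Σ τ, Var Γ τ) = ⟨_, y⟩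
  | _, _, .const _, _, _ => False
  | _, _, .nom _ _, _, _ => False
  | _, _, .app t s, _, x => t.Occurs x ∨ s.Occurs x
  | _, _, .lam t, _, x => t.Occurs (Var.succ x)

/-- `βη`-conversion. -/
inductive Conv : {Γ : Ctx S} → {τ : Ty S.Base} → Raw S Γ τ → Raw S Γ τ → Prop
  | refl {Γ : Ctx S} {τ : Ty S.Base} (t : Raw S Γ τ) : Conv t t
  | symm {Γ : Ctx S} {τ : Ty S.Base} {t s : Raw S Γ τ} : Conv t s → Conv s t
  | trans {Γ : Ctx S} {τ : Ty S.Base} {t s r : Raw S Γ τ} : Conv t s → Conv s r → Conv t r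
  | app {Γ : Ctx S} {α β : Ty S.Base} {t t' : Raw S Γ (Ty.arr α β)} {s s' : Raw S Γ α} :
      Conv t t' → Conv s s' → Conv (.app t s) (.app t' s')
  | lam {Γ : Ctx S} {α β : Ty S.Base} {t t' : Raw S (α :: Γ) β} :
      Conv t t' → Conv (.lam t) (.lam t')
  | beta {Γ : Ctx S} {α β : Ty S.Base} (t : Raw S (α :: Γ) β) (s : Raw S Γ α) :
      Conv (.app (.lam t) s) (t.subst (RawSub.inst s))
  | eta {Γ : Ctx S} {α β : Ty S.Base} (t : Raw S Γ (Ty.arr α β)) :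
      Conv (.lam (.app (t.rename (Ren.wk α)) (.var Var.zero))) t

/-! Conversion is preserved by substitution and by renaming of nominal constants. -/

theorem Raw.rename_rename : ∀ {Γ : Ctx S} {τ : Ty S.Base} (t : Raw S Γ τ) {Δ Θ : Ctx S}
    (ρ : Ren Γ Δ) (ρ' : Ren Δ Θ),
    (t.rename ρ).rename ρ' = t.rename (fun τ x => ρ' τ (ρ τ x)) := by
  intro Γ τ t
  induction t with
  | var x => intros; rfl
  | const c => intros; rfl
  | nom τ k => intros; rfl
  | app t s iht ihs => intro Δ Θ ρ ρ'; simp only [Raw.rename, iht, ihs]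
  | lam t ih =>
    intro Δ Θ ρ ρ'
    simp only [Raw.rename, ih]
    congr 2
    funext τ x
    cases x <;> rfl

theorem Raw.subst_rename : ∀ {Γ : Ctx S} {τ : Ty S.Base} (t : Raw S Γ τ) {Δ Θ : Ctx S}
    (ρ : Ren Γ Δ) (σ : RawSub Δ Θ),
    (t.rename ρ).subst σ = t.subst (fun τ x => σ τ (ρ τ x)) := by
  intro Γ τ t
  induction t with
  | var x => intros; rfl
  | const c => intros; rfl
  | nom τ k => intros; rfl
  | app t s iht ihs => intro Δ Θ ρ σ; simp only [Raw.rename, Raw.subst, iht, ihs]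
  | lam t ih =>
    intro Δ Θ ρ σ
    simp only [Raw.rename, Raw.subst, ih]
    congr 2
    funext τ x
    cases x <;> rfl

theorem Raw.rename_subst : ∀ {Γ : Ctx S} {τ : Ty S.Base} (t : Raw S Γ τ) {Δ Θ : Ctx S}
    (σ : RawSub Γ Δ) (ρ : Ren Δ Θ),
    (t.subst σ).rename ρ = t.subst (fun τ x => (σ τ x).rename ρ) := by
  intro Γ τ t
  induction t with
  | var x => intros; rfl
  | const c => intros; rfl
  | nom τ k => intros; rfl
  | app t s iht ihs => intro Δ Θ σ ρ; simp only [Raw.rename, Raw.subst, iht, ihs]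
  | lam t ih =>
    intro Δ Θ σ ρ
    simp only [Raw.rename, Raw.subst, ih]
    congr 2
    funext τ x
    cases x with
    | zero => rfl
    | succ x =>
      simp only [RawSub.lift, Raw.rename_rename]
      rfl

theorem Raw.subst_subst : ∀ {Γ : Ctx S} {τ : Ty S.Base} (t : Raw S Γ τ) {Δ Θ : Ctx S}
    (σ : RawSub Γ Δ) (σ' : RawSub Δ Θ),
    (t.subst σ).subst σ' = t.subst (fun τ x => (σ τ x).subst σ') := by
  intro Γ τ t
  induction t with
  | var x => intros; rfl
  | const c => intros; rfl
  | nom τ k => intros; rfl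
  | app t s iht ihs => intro Δ Θ σ σ'; simp only [Raw.subst, iht, ihs]
  | lam t ih =>
    intro Δ Θ σ σ'
    simp only [Raw.subst, ih]
    congr 2
    funext τ x
    cases x with
    | zero => rfl
    | succ x =>
      simp only [RawSub.lift, Raw.subst_rename, Raw.rename_subst]
      rfl

theorem Raw.subst_var : ∀ {Γ : Ctx S} {τ : Ty S.Base} (t : Raw S Γ τ),
    t.subst (fun _ x => .var x) = t := by
  intro Γ τ t
  induction t with
  | var x => rfl
  | const c => rfl
  | nom τ k => rfl
  | app t s iht ihs => simp only [Raw.subst, iht, ihs]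
  | @lam Γ α β t ih =>
    have h : RawSub.lift (fun _ x => .var x : RawSub Γ Γ) α = fun _ x => .var x := by
      funext τ x
      cases x <;> rfl
    simp only [Raw.subst, h, ih]

theorem Raw.perm_rename (π : NomPerm S) : ∀ {Γ : Ctx S} {τ : Ty S.Base} (t : Raw S Γ τ) {Δ : Ctx S}
    (ρ : Ren Γ Δ), (t.rename ρ).perm π = (t.perm π).rename ρ := by
  intro Γ τ t
  induction t with
  | var x => intros; rfl
  | const c => intros; rfl
  | nom τ k => intros; rfl
  | app t s iht ihs => intro Δ ρ; simp only [Raw.rename, Raw.perm, iht, ihs]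
  | lam t ih => intro Δ ρ; simp only [Raw.rename, Raw.perm, ih]

theorem Raw.perm_subst (π : NomPerm S) : ∀ {Γ : Ctx S} {τ : Ty S.Base} (t : Raw S Γ τ) {Δ : Ctx S}
    (σ : RawSub Γ Δ), (t.subst σ).perm π = (t.perm π).subst (fun τ x => (σ τ x).perm π) := by
  intro Γ τ t
  induction t with
  | var x => intros; rfl
  | const c => intros; rfl
  | nom τ k => intros; rfl
  | app t s iht ihs => intro Δ σ; simp only [Raw.subst, Raw.perm, iht, ihs]
  | lam t ih =>
    intro Δ σ
    simp only [Raw.subst, Raw.perm, ih]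
    congr 2
    funext τ x
    cases x with
    | zero => rfl
    | succ x => simp only [RawSub.lift, Raw.perm_rename]

theorem Conv.subst {Γ : Ctx S} {τ : Ty S.Base} {t t' : Raw S Γ τ} (h : Conv t t') :
    ∀ {Δ : Ctx S} (σ : RawSub Γ Δ), Conv (t.subst σ) (t'.subst σ) := by
  induction h with
  | refl t => intros; exact .refl _
  | symm _ ih => intro Δ σ; exact .symm (ih σ)
  | trans _ _ ih₁ ih₂ => intro Δ σ; exact .trans (ih₁ σ) (ih₂ σ)
  | app _ _ ih₁ ih₂ => intro Δ σ; exact .app (ih₁ σ) (ih₂ σ)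
  | lam _ ih => intro Δ σ; exact .lam (ih _)
  | beta t s =>
    intro Δ σ
    have e : (t.subst (RawSub.inst s)).subst σ
        = (t.subst (σ.lift _)).subst (RawSub.inst (s.subst σ)) := by
      rw [Raw.subst_subst, Raw.subst_subst]
      congr 1
      funext τ x
      cases x with
      | zero => rfl
      | succ x =>
        simp only [RawSub.lift, RawSub.inst, Raw.subst_rename, Ren.wk, Raw.subst, Raw.subst_var]
    rw [e]
    exact .beta _ _
  | @eta _ α _ t =>
    intro Δ σ
    have e : (t.rename (Ren.wk α)).subst (σ.lift α) = (t.subst σ).rename (Ren.wk α) := by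
      rw [Raw.subst_rename, Raw.rename_subst]
      rfl
    simp only [Raw.subst, e]
    exact .eta _

theorem Conv.rename {Γ : Ctx S} {τ : Ty S.Base} {t t' : Raw S Γ τ} (h : Conv t t') {Δ : Ctx S}
    (ρ : Ren Γ Δ) : Conv (t.rename ρ) (t'.rename ρ) := by
  have e : ∀ r : Raw S Γ τ, r.rename ρ = r.subst (fun τ x => .var (ρ τ x)) := fun r => by
    rw [← Raw.subst_var (r.rename ρ), Raw.subst_rename]
  rw [e, e]
  exact h.subst _

theorem Conv.subst_right : ∀ {Γ : Ctx S} {τ : Ty S.Base} (t : Raw S Γ τ) {Δ : Ctx S}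
    {σ σ' : RawSub Γ Δ}, (∀ τ x, Conv (σ τ x) (σ' τ x)) → Conv (t.subst σ) (t.subst σ') := by
  intro Γ τ t
  induction t with
  | var x => intro Δ σ σ' h; exact h _ x
  | const c => intros; exact .refl _
  | nom τ k => intros; exact .refl _
  | app t s iht ihs => intro Δ σ σ' h; exact .app (iht h) (ihs h)
  | lam t ih =>
    intro Δ σ σ' h
    refine .lam (ih fun τ x => ?_)
    cases x with
    | zero => exact .refl _
    | succ x => exact (h _ x).rename _

theorem Conv.perm (π : NomPerm S) {Γ : Ctx S} {τ : Ty S.Base} {t t' : Raw S Γ τ}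
    (h : Conv t t') : Conv (t.perm π) (t'.perm π) := by
  induction h with
  | refl t => exact .refl _
  | symm _ ih => exact .symm ih
  | trans _ _ ih₁ ih₂ => exact .trans ih₁ ih₂
  | app _ _ ih₁ ih₂ => exact .app ih₁ ih₂
  | lam _ ih => exact .lam ih
  | beta t s =>
    rw [Raw.perm_subst]
    have e : (fun τ x => (RawSub.inst s τ x).perm π) = RawSub.inst (s.perm π) := by
      funext τ x
      cases x <;> rfl
    rw [e]
    exact .beta _ _
  | eta t =>
    simp only [Raw.perm, Raw.perm_rename]
    exact .eta _

/-- Extending a predicate that singles out the bound variables under one more binder. -/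
def boundLift {Γ : Ctx S} (b : ∀ τ : Ty S.Base, Var Γ τ → Prop) (α : Ty S.Base) :
    ∀ τ : Ty S.Base, Var (α :: Γ) τ → Prop
  | _, Var.zero => True
  | _, Var.succ x => b _ x

/-- `IsFlex b t l`: `t` is a free (i.e. not bound) variable applied to the list `l` of pairwise
distinct bound variables; `b` says which variables are bound. -/
inductive IsFlex {Γ : Ctx S} (b : ∀ τ : Ty S.Base, Var Γ τ → Prop) :
    {τ : Ty S.Base} → Raw S Γ τ → List (Σ τ : Ty S.Base, Var Γ τ) → Prop
  | head {τ : Ty S.Base} (x : Var Γ τ) : ¬ b τ x → IsFlex b (.var x) []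
  | app {α β : Ty S.Base} {t : Raw S Γ (Ty.arr α β)} {l : List (Σ τ : Ty S.Base, Var Γ τ)}
      (y : Var Γ α) : IsFlex b t l → b α y → (⟨α, y⟩ : Σ τ : Ty S.Base, Var Γ τ) ∉ l →
      IsFlex b (.app t (.var y)) (⟨α, y⟩ :: l)

mutual
/-- `β`-normal raw terms in the `L_λ` pattern fragment. -/
inductive IsPat : {Γ : Ctx S} → (∀ τ : Ty S.Base, Var Γ τ → Prop) →
    {τ : Ty S.Base} → Raw S Γ τ → Prop
  | lam {Γ : Ctx S} {b : ∀ τ : Ty S.Base, Var Γ τ → Prop} {α β : Ty S.Base}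
      {t : Raw S (α :: Γ) β} : IsPat (boundLift b α) t → IsPat b (.lam t)
  | flex {Γ : Ctx S} {b : ∀ τ : Ty S.Base, Var Γ τ → Prop} {τ : Ty S.Base} {t : Raw S Γ τ}
      {l : List (Σ τ : Ty S.Base, Var Γ τ)} : IsFlex b t l → IsPat b t
  | rigid {Γ : Ctx S} {b : ∀ τ : Ty S.Base, Var Γ τ → Prop} {τ : Ty S.Base} {t : Raw S Γ τ} :
      IsRigid b t → IsPat b t
/-- A constant, nominal constant or bound variable, applied to patterns. -/
inductive IsRigid : {Γ : Ctx S} → (∀ τ : Ty S.Base, Var Γ τ → Prop) →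
    {τ : Ty S.Base} → Raw S Γ τ → Prop
  | const {Γ : Ctx S} {b : ∀ τ : Ty S.Base, Var Γ τ → Prop} {τ : Ty S.Base} (c : S.Const τ) :
      IsRigid b (.const c)
  | nom {Γ : Ctx S} {b : ∀ τ : Ty S.Base, Var Γ τ → Prop} (τ : Ty S.Base) (k : ℕ) :
      IsRigid b (.nom τ k)
  | var {Γ : Ctx S} {b : ∀ τ : Ty S.Base, Var Γ τ → Prop} {τ : Ty S.Base} (x : Var Γ τ) :
      b τ x → IsRigid b (.var x)
  | app {Γ : Ctx S} {b : ∀ τ : Ty S.Base, Var Γ τ → Prop} {α β : Ty S.Base}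
      {t : Raw S Γ (Ty.arr α β)} {s : Raw S Γ α} :
      IsRigid b t → IsPat b s → IsRigid b (.app t s)
end

end RawTerms

/-! ## Terms modulo `βη` -/

instance convSetoid (S : Signature.{u}) (Γ : Ctx S) (τ : Ty S.Base) : Setoid (Raw S Γ τ) where
  r := Conv
  iseqv := ⟨Conv.refl, Conv.symm, Conv.trans⟩

/-- Terms of type `τ` over the variable context `Γ`, modulo `αβη`. -/
def Tm (S : Signature.{u}) (Γ : Ctx S) (τ : Ty S.Base) : Type u :=
  Quotient (convSetoid S Γ τ)

/-- `Sub Γ Δ`: assignments of a term over `Δ` to each variable of `Γ`.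
An element of `Sub Γ []` is a `Γ`-grounding substitution. -/
abbrev Sub {S : Signature.{u}} (Γ Δ : Ctx S) : Type u := ∀ τ : Ty S.Base, Var Γ τ → Tm S Δ τ

noncomputable section

section Terms

variable {S : Signature.{u}}

def Tm.mk {Γ : Ctx S} {τ : Ty S.Base} (t : Raw S Γ τ) : Tm S Γ τ :=
  Quotient.mk (convSetoid S Γ τ) t

def Tm.var {Γ : Ctx S} {τ : Ty S.Base} (x : Var Γ τ) : Tm S Γ τ := Tm.mk (.var x)

def Tm.nom {Γ : Ctx S} (n : Nominal S) : Tm S Γ n.1 := Tm.mk (.nom n.1 n.2)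

def Tm.app {Γ : Ctx S} {α β : Ty S.Base} (t : Tm S Γ (Ty.arr α β)) (s : Tm S Γ α) : Tm S Γ β :=
  Quotient.liftOn₂ t s (fun t s => Tm.mk (.app t s))
    (fun _ _ _ _ h h' => Quotient.sound (Conv.app h h'))

/-- Substitution `tσ` (independent of the chosen representatives of the terms in `σ`). -/
def Tm.subst {Γ Δ : Ctx S} {τ : Ty S.Base} (t : Tm S Γ τ) (σ : Sub Γ Δ) : Tm S Δ τ :=
  Quotient.liftOn t (fun t => Tm.mk (t.subst (fun τ x => Quotient.out (σ τ x))))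
    (fun _ _ h => Quotient.sound (Conv.subst h _))

theorem Tm.mk_subst {Γ Δ : Ctx S} {τ : Ty S.Base} (t : Raw S Γ τ) (σ : RawSub Γ Δ) :
    (Tm.mk t).subst (fun τ x => Tm.mk (σ τ x)) = Tm.mk (t.subst σ) :=
  Quotient.sound (Conv.subst_right t fun τ x => Quotient.mk_out (s := convSetoid S Δ τ) (σ τ x))

/-- The action `t[π]` of a permutation of nominal constants. -/
def Tm.perm (π : NomPerm S) {Γ : Ctx S} {τ : Ty S.Base} (t : Tm S Γ τ) : Tm S Γ τ :=
  Quotient.liftOn t (fun t => Tm.mk (t.perm π)) (fun _ _ h => Quotient.sound (Conv.perm π h))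

/-- The nominal constants appearing in a term modulo `βη`: those appearing in all of its
representatives (equivalently, in its normal form, as reduction creates no nominal constants). -/
def Tm.supp {Γ : Ctx S} {τ : Ty S.Base} (t : Tm S Γ τ) : Set (Nominal S) :=
  {n | ∀ r : Raw S Γ τ, Tm.mk r = t → n ∈ r.noms}

/-- The variable `x` appears free in the term `t` modulo `βη`, i.e. in all representatives of `t`
(equivalently, in its normal form). -/
def Tm.Occurs {Γ : Ctx S} {τ : Ty S.Base} (t : Tm S Γ τ) {σ : Ty S.Base} (x : Var Γ σ) : Prop :=
  ∀ r : Raw S Γ τ, Tm.mk r = t → r.Occurs x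

/-- The term `t` lies in the `L_λ` pattern fragment: up to `βη`, all its free variables are applied
to pairwise distinct bound variables only. -/
def Tm.IsPattern {Γ : Ctx S} {τ : Ty S.Base} (t : Tm S Γ τ) : Prop :=
  ∃ r : Raw S Γ τ, Tm.mk r = t ∧ IsPat (fun _ _ => False) r

/-- The trivial substitution `ε`. -/
def Sub.id (Γ : Ctx S) : Sub Γ Γ := fun _ x => Tm.var x

/-- The inclusion of a context in its extension by one more variable. -/
def Sub.wk (Γ : Ctx S) (α : Ty S.Base) : Sub Γ (α :: Γ) := fun _ x => Tm.var (Var.succ x)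

def Sub.lift {Γ Δ : Ctx S} (σ : Sub Γ Δ) (α : Ty S.Base) : Sub (α :: Γ) (α :: Δ)
  | _, Var.zero => Tm.var Var.zero
  | _, Var.succ x => (σ _ x).subst (Sub.wk Δ α)

/-- The substitution `[σ, t/x]`, with `x` the most recent variable. -/
def Sub.cons {Γ Δ : Ctx S} {α : Ty S.Base} (t : Tm S Δ α) (σ : Sub Γ Δ) : Sub (α :: Γ) Δ
  | _, Var.zero => t
  | _, Var.succ x => σ _ x

/-- The substitution `[t/x]`, with `x` the most recent variable. -/
def Sub.inst {Γ : Ctx S} {α : Ty S.Base} (t : Tm S Γ α) : Sub (α :: Γ) Γ :=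
  Sub.cons t (Sub.id Γ)

/-- The nominal constants appearing in a substitution. -/
def Sub.supp {Γ Δ : Ctx S} (σ : Sub Γ Δ) : Set (Nominal S) :=
  {n | ∃ (τ : Ty S.Base) (x : Var Γ τ), n ∈ (σ τ x).supp}

/-- `Δ` is the range of `σ`: the terms of `σ` lie over `Δ` (by typing), and every variable
of `Δ` appears in one of them. -/
def Sub.IsRange {Γ Δ : Ctx S} (σ : Sub Γ Δ) : Prop :=
  ∀ (ζ : Ty S.Base) (z : Var Δ ζ), ∃ (τ : Ty S.Base) (x : Var Γ τ), (σ τ x).Occurs z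

/-- `τ₁ → ⋯ → τₖ → τ`, where `τ₁, …, τₖ` are the types of the nominal constants `ns`. -/
def raiseTy (ns : List (Nominal S)) (τ : Ty S.Base) : Ty S.Base :=
  match ns with
  | [] => τ
  | n :: ns => Ty.arr n.1 (raiseTy ns τ)

/-- The application `t n₁ ⋯ nₖ` of `t` to the nominal constants `ns = [n₁, …, nₖ]`. -/
def Tm.appNoms {Γ : Ctx S} {τ : Ty S.Base} :
    (ns : List (Nominal S)) → Tm S Γ (raiseTy ns τ) → Tm S Γ τ
  | [], t => t
  | n :: ns, t => Tm.appNoms ns (Tm.app t (Tm.nom n))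

/-- The substitution `[y n₁ ⋯ nₖ / x]` over the context extended by the new variable `y`. -/
def Sub.raise {Γ : Ctx S} (ns : List (Nominal S)) (α : Ty S.Base) :
    Sub (α :: Γ) (raiseTy ns α :: Γ) :=
  Sub.cons (Tm.appNoms ns (Tm.var Var.zero)) (Sub.wk Γ (raiseTy ns α))

end Terms

/-! ## Formulas -/

/-- Formulas over the variable context `Γ`. The arguments of `p : τ₁ → ⋯ → τₙ → o` are given as an
assignment of a term to each variable of the context `[τ₁, …, τₙ]`. -/
inductive Form (S : Signature.{u}) : Ctx S → Type u
  | atom {Γ : Ctx S} (p : S.Pred) (ts : Sub (S.arity p) Γ) : Form S Γ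
  | bot {Γ : Ctx S} : Form S Γ
  | top {Γ : Ctx S} : Form S Γ
  | and {Γ : Ctx S} (A B : Form S Γ) : Form S Γ
  | or {Γ : Ctx S} (A B : Form S Γ) : Form S Γ
  | imp {Γ : Ctx S} (A B : Form S Γ) : Form S Γ
  | all {Γ : Ctx S} (α : Ty S.Base) (C : Form S (α :: Γ)) : Form S Γ
  | ex {Γ : Ctx S} (α : Ty S.Base) (C : Form S (α :: Γ)) : Form S Γ
  | nabla {Γ : Ctx S} (α : Ty S.Base) (C : Form S (α :: Γ)) : Form S Γ

section Formulas

variable {S : Signature.{u}}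

/-- Substitution of terms for variables in a formula. -/
def Form.subst : {Γ : Ctx S} → Form S Γ → {Δ : Ctx S} → Sub Γ Δ → Form S Δ
  | _, .atom p ts, _, σ => .atom p (fun τ x => (ts τ x).subst σ)
  | _, .bot, _, _ => .bot
  | _, .top, _, _ => .top
  | _, .and A B, _, σ => .and (A.subst σ) (B.subst σ)
  | _, .or A B, _, σ => .or (A.subst σ) (B.subst σ)
  | _, .imp A B, _, σ => .imp (A.subst σ) (B.subst σ)
  | _, .all α C, _, σ => .all α (C.subst (σ.lift α))
  | _, .ex α C, _, σ => .ex α (C.subst (σ.lift α))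
  | _, .nabla α C, _, σ => .nabla α (C.subst (σ.lift α))

/-- The action `F[π]` of a permutation of nominal constants. -/
def Form.perm (π : NomPerm S) : {Γ : Ctx S} → Form S Γ → Form S Γ
  | _, .atom p ts => .atom p (fun τ x => (ts τ x).perm π)
  | _, .bot => .bot
  | _, .top => .top
  | _, .and A B => .and (A.perm π) (B.perm π)
  | _, .or A B => .or (A.perm π) (B.perm π)
  | _, .imp A B => .imp (A.perm π) (B.perm π)
  | _, .all α C => .all α (C.perm π)
  | _, .ex α C => .ex α (C.perm π)
  | _, .nabla α C => .nabla α (C.perm π)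

/-- The support of a formula: the nominal constants appearing in it. -/
def Form.supp : {Γ : Ctx S} → Form S Γ → Set (Nominal S)
  | _, .atom _ ts => Sub.supp ts
  | _, .bot => ∅
  | _, .top => ∅
  | _, .and A B => A.supp ∪ B.supp
  | _, .or A B => A.supp ∪ B.supp
  | _, .imp A B => A.supp ∪ B.supp
  | _, .all _ C => C.supp
  | _, .ex _ C => C.supp
  | _, .nabla _ C => C.supp

/-- Replacing every atom `q t⃗` in a formula by `P t⃗`, where `P = λx⃗. f q` is the closed term of
the type of `q` given by the formula `f q` over the context of the arguments of `q`. -/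
def Form.predSubst (f : ∀ q : S.Pred, Form S (S.arity q)) : {Γ : Ctx S} → Form S Γ → Form S Γ
  | _, .atom q ts => (f q).subst ts
  | _, .bot => .bot
  | _, .top => .top
  | _, .and A B => .and (A.predSubst f) (B.predSubst f)
  | _, .or A B => .or (A.predSubst f) (B.predSubst f)
  | _, .imp A B => .imp (A.predSubst f) (B.predSubst f)
  | _, .all α C => .all α (C.predSubst f)
  | _, .ex α C => .ex α (C.predSubst f)
  | _, .nabla α C => .nabla α (C.predSubst f)

open Classical in
/-- Replacing every atom `p t⃗` in `F` by `P t⃗`, where `P = λx⃗. I`; all other atoms are kept. -/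
def Form.replacePred {Γ : Ctx S} (F : Form S Γ) (p : S.Pred) (I : Form S (S.arity p)) : Form S Γ :=
  F.predSubst (Function.update (fun q => Form.atom q (Sub.id (S.arity q))) p I)

end Formulas

/-! ## Definitions and inductive definitions -/

/-- A clause `p t⃗ =Δ B`, with `t⃗` and `B` over the variable context `ctx`. -/
structure Clause (S : Signature.{u}) where
  ctx : Ctx S
  pred : S.Pred
  args : Sub (S.arity pred) ctx
  body : Form S ctx

def Clause.head {S : Signature.{u}} (c : Clause S) : Form S c.ctx := .atom c.pred c.args

/-- Inductive definitions: at most one clause `p x⃗ =μ B p x⃗` for each predicate constant `p`.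
The closed term `B` is represented by the formula `B p x⃗` over the context of the arguments of `p`,
and `B P x⃗` is obtained from it by replacing `p` by `P`: as `B` does not contain `p`, the occurrences
of `p` in `B p x⃗` are those of the argument of `B`, and every formula over the context of the
arguments of `p` is `B p x⃗` for a unique such `B`. -/
abbrev IndDefs (S : Signature.{u}) : Type u :=
  ∀ p : S.Pred, Option (Form S (S.arity p))

section Logic

variable {S : Signature.{u}}

/-- `D` is a valid set of definitions: in each clause the head and the body have empty support,
every variable of the context appears in the head, and the head is in the pattern fragment. -/
def ValidDefs (D : Set (Clause S)) : Prop :=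
  ∀ c ∈ D, c.head.supp = ∅ ∧ c.body.supp = ∅ ∧
    (∀ (ζ : Ty S.Base) (z : Var c.ctx ζ), ∃ (τ : Ty S.Base) (x : Var (S.arity c.pred) τ),
      (c.args τ x).Occurs z) ∧
    ∀ (τ : Ty S.Base) (x : Var (S.arity c.pred) τ), (c.args τ x).IsPattern

/-- `I` is a valid set of inductive definitions (relative to `D`): the operators are closed, contain
no nominal constants, and no predicate constant is defined in both `D` and `I`. -/
def ValidInd (D : Set (Clause S)) (I : IndDefs S) : Prop :=
  ∀ (p : S.Pred) (B : Form S (S.arity p)), I p = some B →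
    B.supp = ∅ ∧ ∀ c ∈ D, c.pred ≠ p

/-- A level assignment to the ground atomic formulas, together with its extension to
all ground formulas. -/
structure IsLevel (lvl : Form S [] → Ordinal.{v}) : Prop where
  bot : lvl .bot = 0
  top : lvl .top = 0
  and (A B : Form S []) : lvl (.and A B) = max (lvl A) (lvl B)
  or (A B : Form S []) : lvl (.or A B) = max (lvl A) (lvl B)
  imp (A B : Form S []) : lvl (.imp A B) = max (lvl A + 1) (lvl B)
  all (α : Ty S.Base) (C : Form S [α]) :
    IsLUB (Set.range fun t : Tm S [] α => lvl (C.subst (Sub.inst t))) (lvl (.all α C))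
  ex (α : Ty S.Base) (C : Form S [α]) :
    IsLUB (Set.range fun t : Tm S [] α => lvl (C.subst (Sub.inst t))) (lvl (.ex α C))
  nabla (α : Ty S.Base) (C : Form S [α]) (k : ℕ) : (α, k) ∉ C.supp →
    lvl (.nabla α C) = lvl (C.subst (Sub.inst (Tm.nom (α, k))))

/-- `D` is weakly stratified with respect to the levels `lvl`. -/
def WeaklyStratified (lvl : Form S [] → Ordinal.{v}) (D : Set (Clause S)) : Prop :=
  ∀ c ∈ D, ∀ ρ : Sub c.ctx [], lvl (c.body.subst ρ) ≤ lvl (c.head.subst ρ)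

/-- `I` is (strictly) stratified with respect to the levels `lvl`: for each clause
`p x⃗ =μ B p x⃗`, the level of `p t⃗` does not depend on the ground arguments `t⃗`, and is at least
the level of `B p t⃗`. -/
def StrictlyStratified (lvl : Form S [] → Ordinal.{v}) (I : IndDefs S) : Prop :=
  ∀ (p : S.Pred) (B : Form S (S.arity p)), I p = some B →
    (∀ ρ : Sub (S.arity p) [], lvl (B.subst ρ) ≤ lvl (.atom p ρ)) ∧
    ∀ ρ₁ ρ₂ : Sub (S.arity p) [], lvl (.atom p ρ₁) = lvl (.atom p ρ₂)

/-- `Defn c A θ B'`: `θ` has empty support, and there is a substitution `ρ` with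
`c.head ρ = A θ` and `B' = c.body ρ`. -/
def Defn (c : Clause S) {Y Z : Ctx S} (A : Form S Y) (θ : Sub Y Z) (B' : Form S Z) : Prop :=
  θ.supp = ∅ ∧ ∃ ρ : Sub c.ctx Z, c.head.subst ρ = A.subst θ ∧ B' = c.body.subst ρ

/-- `Derivable D I X Γ C`: the sequent `X; Γ ⊢ C` is derivable in the logic given by the definitions
`D` and the inductive definitions `I`. -/
inductive Derivable (D : Set (Clause S)) (I : IndDefs S) :
    (X : Ctx S) → Multiset (Form S X) → Form S X → Prop
  -- core rules
  | botL {X : Ctx S} (Γ : Multiset (Form S X)) (B : Form S X) : Derivable D I X (.bot ::ₘ Γ) B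
  | topR {X : Ctx S} (Γ : Multiset (Form S X)) : Derivable D I X Γ .top
  | impL {X : Ctx S} {Γ : Multiset (Form S X)} {B C E : Form S X} :
      Derivable D I X Γ B → Derivable D I X (C ::ₘ Γ) E → Derivable D I X (.imp B C ::ₘ Γ) E
  | impR {X : Ctx S} {Γ : Multiset (Form S X)} {B C : Form S X} :
      Derivable D I X (B ::ₘ Γ) C → Derivable D I X Γ (.imp B C)
  | andL₁ {X : Ctx S} {Γ : Multiset (Form S X)} {B C E : Form S X} :
      Derivable D I X (B ::ₘ Γ) E → Derivable D I X (.and B C ::ₘ Γ) E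
  | andL₂ {X : Ctx S} {Γ : Multiset (Form S X)} {B C E : Form S X} :
      Derivable D I X (C ::ₘ Γ) E → Derivable D I X (.and B C ::ₘ Γ) E
  | andR {X : Ctx S} {Γ : Multiset (Form S X)} {B C : Form S X} :
      Derivable D I X Γ B → Derivable D I X Γ C → Derivable D I X Γ (.and B C)
  | orL {X : Ctx S} {Γ : Multiset (Form S X)} {B C E : Form S X} :
      Derivable D I X (B ::ₘ Γ) E → Derivable D I X (C ::ₘ Γ) E →
      Derivable D I X (.or B C ::ₘ Γ) E
  | orR₁ {X : Ctx S} {Γ : Multiset (Form S X)} {B C : Form S X} :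
      Derivable D I X Γ B → Derivable D I X Γ (.or B C)
  | orR₂ {X : Ctx S} {Γ : Multiset (Form S X)} {B C : Form S X} :
      Derivable D I X Γ C → Derivable D I X Γ (.or B C)
  | allL {X : Ctx S} {Γ : Multiset (Form S X)} {α : Ty S.Base} {C : Form S (α :: X)}
      {E : Form S X} (t : Tm S X α) :
      Derivable D I X (C.subst (Sub.inst t) ::ₘ Γ) E → Derivable D I X (.all α C ::ₘ Γ) E
  | allR {X : Ctx S} {Γ : Multiset (Form S X)} {α : Ty S.Base} {C : Form S (α :: X)}
      (ns : List (Nominal S)) : ns.Nodup → (∀ n, n ∈ ns ↔ n ∈ C.supp) →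
      Derivable D I (raiseTy ns α :: X) (Γ.map fun G => G.subst (Sub.wk X (raiseTy ns α)))
        (C.subst (Sub.raise ns α)) →
      Derivable D I X Γ (.all α C)
  | exL {X : Ctx S} {Γ : Multiset (Form S X)} {α : Ty S.Base} {C : Form S (α :: X)}
      {E : Form S X} (ns : List (Nominal S)) : ns.Nodup → (∀ n, n ∈ ns ↔ n ∈ C.supp) →
      Derivable D I (raiseTy ns α :: X)
        (C.subst (Sub.raise ns α) ::ₘ Γ.map fun G => G.subst (Sub.wk X (raiseTy ns α)))
        (E.subst (Sub.wk X (raiseTy ns α))) →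
      Derivable D I X (.ex α C ::ₘ Γ) E
  | exR {X : Ctx S} {Γ : Multiset (Form S X)} {α : Ty S.Base} {C : Form S (α :: X)}
      (t : Tm S X α) :
      Derivable D I X Γ (C.subst (Sub.inst t)) → Derivable D I X Γ (.ex α C)
  | nablaL {X : Ctx S} {Γ : Multiset (Form S X)} {α : Ty S.Base} {C : Form S (α :: X)}
      {E : Form S X} (k : ℕ) : (α, k) ∉ C.supp →
      Derivable D I X (C.subst (Sub.inst (Tm.nom (α, k))) ::ₘ Γ) E →
      Derivable D I X (.nabla α C ::ₘ Γ) E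
  | nablaR {X : Ctx S} {Γ : Multiset (Form S X)} {α : Ty S.Base} {C : Form S (α :: X)}
      (k : ℕ) : (α, k) ∉ C.supp →
      Derivable D I X Γ (C.subst (Sub.inst (Tm.nom (α, k)))) → Derivable D I X Γ (.nabla α C)
  -- structural rules, axiom, multicut
  | contrL {X : Ctx S} {Γ : Multiset (Form S X)} {B C : Form S X} :
      Derivable D I X (B ::ₘ B ::ₘ Γ) C → Derivable D I X (B ::ₘ Γ) C
  | weakL {X : Ctx S} {Γ : Multiset (Form S X)} {B C : Form S X} :
      Derivable D I X Γ C → Derivable D I X (B ::ₘ Γ) C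
  | ax {X : Ctx S} (p : S.Pred) (ts : Sub (S.arity p) X) (π : NomPerm S) :
      (∀ (τ : Ty S.Base) (k : ℕ), (τ, k) ∉ (Form.atom p ts).supp → π τ k = k) →
      Derivable D I X {Form.atom p ts} ((Form.atom p ts).perm π)
  | mc {X : Ctx S} {Γ : Multiset (Form S X)} {C : Form S X}
      (cuts : List (Multiset (Form S X) × Form S X)) :
      (∀ c ∈ cuts, Derivable D I X c.1 c.2) →
      Derivable D I X (Γ + (cuts.map Prod.snd : List (Form S X))) C →
      Derivable D I X (Γ + (cuts.map Prod.fst).sum) C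
  -- definitions; the left rule is for predicates that have no inductive definition
  | defL {X : Ctx S} {Γ : Multiset (Form S X)} {C : Form S X} (p : S.Pred)
      (ts : Sub (S.arity p) X) : I p = none →
      (∀ c ∈ D, ∀ (Z : Ctx S) (θ : Sub X Z) (B' : Form S Z), θ.IsRange →
        Defn c (Form.atom p ts) θ B' →
        Derivable D I Z (B' ::ₘ Γ.map fun G => G.subst θ) (C.subst θ)) →
      Derivable D I X (Form.atom p ts ::ₘ Γ) C
  | defR {X : Ctx S} {Γ : Multiset (Form S X)} (c : Clause S) (p : S.Pred)
      (ts : Sub (S.arity p) X) (B' : Form S X) : c ∈ D →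
      Defn c (Form.atom p ts) (Sub.id X) B' →
      Derivable D I X Γ B' → Derivable D I X Γ (Form.atom p ts)
  -- inductive definitions; the invariant `λx⃗. J` is closed and contains no nominal constants
  | indL {X : Ctx S} {Γ : Multiset (Form S X)} {C : Form S X} (p : S.Pred)
      (B J : Form S (S.arity p)) (ts : Sub (S.arity p) X) : I p = some B → J.supp = ∅ →
      Derivable D I (S.arity p) {B.replacePred p J} J →
      Derivable D I X (J.subst ts ::ₘ Γ) C →
      Derivable D I X (Form.atom p ts ::ₘ Γ) C
  | indR {X : Ctx S} {Γ : Multiset (Form S X)} (p : S.Pred) (B : Form S (S.arity p))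
      (ts : Sub (S.arity p) X) : I p = some B →
      Derivable D I X Γ (B.subst ts) → Derivable D I X Γ (Form.atom p ts)

end Logic

end

end LD

-- Consistency is proved semantically: every derivable sequent is true in a model built on ground
-- terms, and `⊥` is not. A predicate is read as a set of tuples of ground terms. Truth uses two
-- interpretations: in `Form.True N M` the atoms in antecedents are read by `N` and all others by
-- `M`. Truth is then monotone in `M`, so for fixed `N` the clauses of `D` and `I` have a least
-- interpretation `least D I N` closed under unfolding. Antecedents have strictly lower level than
-- the implication, so the part of `least D I N` at a given level depends on `N` only at lower
-- levels (`least_congr_of_lt`). Recursion on levels therefore gives an `M` with `least D I M = M`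
-- (`exists_model`), and induction on levels shows it is unique (`model_unique`). Such an `M` is a
-- fixed point of unfolding, which validates the rules for definitions. Its minimality validates
-- induction (`model_induction`); there strict stratification matters, since the atoms of `p`, all
-- of one level, cannot influence the antecedents in the body of `p`.
--
-- Nominal constants are handled by symmetry. Clauses contain none, so permuting them turns the
-- model into another fixed point, hence into itself (`model_perm`). The quantifier `∇` means "for
-- cofinitely many nominal constants", which by invariance is the same as "for one fresh constant"
-- (`Form.true_nabla_iff`). A sequent is valid if it holds under all grounding substitutions
-- avoiding its nominal constants. By invariance any further finite set may be avoided as well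
-- (`Valid.of_disjoint`), so premises with a different support cause no trouble. This restriction is
-- what makes sound the axiom up to permutation, the raised variables in the rules for `∀` and `∃`
-- (`exists_true_raise_iff`), and `defL`, whose unifiers have empty support: the nominal constants
-- of a grounding substitution are turned into variables (`exists_defn_of_subst_eq`).

namespace LD

-- Simultaneous substitution for variables and nominal constants in raw terms.

section RawBind

variable {S : Signature.{u}}

/-- Assignments of raw terms over `Δ` to the variables of `Γ` and to the nominal constants. -/
abbrev RawEnv (Γ Δ : Ctx S) : Type u := ∀ τ : Ty S.Base, Var Γ τ ⊕ ℕ → Raw S Δ τ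

def RawEnv.lift {Γ Δ : Ctx S} (E : RawEnv Γ Δ) (α : Ty S.Base) : RawEnv (α :: Γ) (α :: Δ)
  | _, .inl Var.zero => .var Var.zero
  | _, .inl (Var.succ x) => (E _ (.inl x)).rename (Ren.wk α)
  | _, .inr k => (E _ (.inr k)).rename (Ren.wk α)

/-- Simultaneous substitution for the variables and the nominal constants. -/
def Raw.bind : {Γ : Ctx S} → {τ : Ty S.Base} → Raw S Γ τ → {Δ : Ctx S} → RawEnv Γ Δ → Raw S Δ τ
  | _, _, .var x, _, E => E _ (.inl x)
  | _, _, .const c, _, _ => .const c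
  | _, _, .nom _ k, _, E => E _ (.inr k)
  | _, _, .app t s, _, E => .app (t.bind E) (s.bind E)
  | _, _, .lam t, _, E => .lam (t.bind (E.lift _))

theorem Raw.bind_rename {Γ : Ctx S} {τ : Ty S.Base} (t : Raw S Γ τ) : ∀ {Δ Θ : Ctx S}
    (E : RawEnv Γ Δ) (ρ : Ren Δ Θ),
    (t.bind E).rename ρ = t.bind (fun τ x => (E τ x).rename ρ) := by
  induction t with
  | var x => intros; rfl
  | const c => intros; rfl
  | nom τ k => intros; rfl
  | app t s iht ihs => intro Δ Θ E ρ; simp only [Raw.rename, Raw.bind, iht, ihs]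
  | lam t ih =>
    intro Δ Θ E ρ
    simp only [Raw.rename, Raw.bind, ih]
    congr 2
    funext τ x
    rcases x with (_ | x) | k
    · rfl
    · simp only [RawEnv.lift, Raw.rename_rename]; rfl
    · simp only [RawEnv.lift, Raw.rename_rename]; rfl

theorem Raw.rename_bind {Γ : Ctx S} {τ : Ty S.Base} (t : Raw S Γ τ) : ∀ {Δ Θ : Ctx S}
    (ρ : Ren Γ Δ) (E : RawEnv Δ Θ),
    (t.rename ρ).bind E = t.bind (fun τ x => E τ (x.map (ρ τ) id)) := by
  induction t with
  | var x => intros; rfl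
  | const c => intros; rfl
  | nom τ k => intros; rfl
  | app t s iht ihs => intro Δ Θ ρ E; simp only [Raw.rename, Raw.bind, iht, ihs]
  | lam t ih =>
    intro Δ Θ ρ E
    simp only [Raw.rename, Raw.bind, ih]
    congr 2
    funext τ x
    rcases x with (_ | x) | k <;> rfl

theorem Raw.bind_bind {Γ : Ctx S} {τ : Ty S.Base} (t : Raw S Γ τ) : ∀ {Δ Θ : Ctx S}
    (E : RawEnv Γ Δ) (E' : RawEnv Δ Θ),
    (t.bind E).bind E' = t.bind (fun τ x => (E τ x).bind E') := by
  induction t with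
  | var x => intros; rfl
  | const c => intros; rfl
  | nom τ k => intros; rfl
  | app t s iht ihs => intro Δ Θ E E'; simp only [Raw.bind, iht, ihs]
  | lam t ih =>
    intro Δ Θ E E'
    simp only [Raw.bind, ih]
    congr 2
    funext τ x
    rcases x with (_ | x) | k
    · rfl
    · simp only [RawEnv.lift, Raw.rename_bind, Raw.bind_rename]
      congr 1; funext τ x; rcases x with x | k <;> rfl
    · simp only [RawEnv.lift, Raw.rename_bind, Raw.bind_rename]
      congr 1; funext τ x; rcases x with x | k <;> rfl

theorem Raw.subst_eq_bind {Γ : Ctx S} {τ : Ty S.Base} (t : Raw S Γ τ) : ∀ {Δ : Ctx S}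
    (σ : RawSub Γ Δ), t.subst σ = t.bind (fun τ => Sum.elim (σ τ) (.nom τ)) := by
  induction t with
  | var x => intros; rfl
  | const c => intros; rfl
  | nom τ k => intros; rfl
  | app t s iht ihs => intro Δ σ; simp only [Raw.subst, Raw.bind, iht, ihs]
  | lam t ih =>
    intro Δ σ
    simp only [Raw.subst, Raw.bind, ih]
    congr 2
    funext τ x
    rcases x with (_ | x) | k <;> rfl

theorem Raw.perm_eq_bind (π : NomPerm S) {Γ : Ctx S} {τ : Ty S.Base} (t : Raw S Γ τ) :
    t.perm π = t.bind (fun τ => Sum.elim .var (fun k => .nom τ (π τ k))) := by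
  induction t with
  | var x => rfl
  | const c => rfl
  | nom τ k => rfl
  | app t s iht ihs => simp only [Raw.perm, Raw.bind, iht, ihs]
  | lam t ih =>
    simp only [Raw.perm, Raw.bind, ih]
    congr 2
    funext τ x
    rcases x with (_ | x) | k <;> rfl

/-- Conversion treats nominal constants like free variables, so putting arbitrary terms for them
respects it. This makes `Tm.bind` well defined. -/
theorem Conv.bind {Γ : Ctx S} {τ : Ty S.Base} {t t' : Raw S Γ τ} (h : Conv t t') :
    ∀ {Δ : Ctx S} (E : RawEnv Γ Δ), Conv (t.bind E) (t'.bind E) := by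
  induction h with
  | refl t => intros; exact .refl _
  | symm _ ih => intro Δ E; exact .symm (ih E)
  | trans _ _ ih₁ ih₂ => intro Δ E; exact .trans (ih₁ E) (ih₂ E)
  | app _ _ ih₁ ih₂ => intro Δ E; exact .app (ih₁ E) (ih₂ E)
  | lam _ ih => intro Δ E; exact .lam (ih _)
  | beta t s =>
    intro Δ E
    have e : (t.subst (RawSub.inst s)).bind E
        = (t.bind (E.lift _)).subst (RawSub.inst (s.bind E)) := by
      rw [Raw.subst_eq_bind, Raw.subst_eq_bind, Raw.bind_bind, Raw.bind_bind]
      congr 1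
      funext τ x
      rcases x with (_ | x) | k
      · rfl
      · simp only [RawEnv.lift, ← Raw.subst_eq_bind, Raw.subst_rename]
        exact (Raw.subst_var _).symm
      · simp only [RawEnv.lift, ← Raw.subst_eq_bind, Raw.subst_rename]
        exact (Raw.subst_var _).symm
    rw [e]
    exact .beta _ _
  | @eta _ α _ t =>
    intro Δ E
    have e : (t.rename (Ren.wk α)).bind (E.lift α) = (t.bind E).rename (Ren.wk α) := by
      rw [Raw.rename_bind, Raw.bind_rename]
      congr 1; funext τ x; rcases x with x | k <;> rfl
    simp only [Raw.bind, e]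
    exact .eta _

theorem Conv.bind_right {Γ : Ctx S} {τ : Ty S.Base} (t : Raw S Γ τ) : ∀ {Δ : Ctx S}
    {E E' : RawEnv Γ Δ}, (∀ τ x, Conv (E τ x) (E' τ x)) → Conv (t.bind E) (t.bind E') := by
  induction t with
  | var x => intro Δ E E' h; exact h _ _
  | const c => intros; exact .refl _
  | nom τ k => intro Δ E E' h; exact h _ _
  | app t s iht ihs => intro Δ E E' h; exact .app (iht h) (ihs h)
  | lam t ih =>
    intro Δ E E' h
    refine .lam (ih fun τ x => ?_)
    rcases x with (_ | x) | k
    · exact .refl _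
    · exact (h _ _).rename _
    · exact (h _ _).rename _

theorem Raw.bind_congr {Γ : Ctx S} {τ : Ty S.Base} (t : Raw S Γ τ) : ∀ {Δ : Ctx S}
    {E E' : RawEnv Γ Δ}, (∀ τ (x : Var Γ τ), t.Occurs x → E τ (.inl x) = E' τ (.inl x)) →
    (∀ τ k, (τ, k) ∈ t.noms → E τ (.inr k) = E' τ (.inr k)) → t.bind E = t.bind E' := by
  induction t with
  | var x => intro Δ E E' h _; exact h _ x rfl
  | const c => intros; rfl
  | nom τ k => intro Δ E E' _ h; exact h _ _ rfl
  | app t s iht ihs =>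
    intro Δ E E' h h'
    simp only [Raw.bind]
    rw [iht (fun τ x hx => h τ x (.inl hx)) (fun τ k hk => h' τ k (.inl hk)),
      ihs (fun τ x hx => h τ x (.inr hx)) (fun τ k hk => h' τ k (.inr hk))]
  | lam t ih =>
    intro Δ E E' h h'
    simp only [Raw.bind]
    congr 1
    apply ih
    · intro τ x hx
      cases x with
      | zero => rfl
      | succ x => exact congrArg (Raw.rename · _) (h τ x hx)
    · intro τ k hk
      exact congrArg (Raw.rename · _) (h' τ k hk)

theorem Raw.noms_rename {Γ : Ctx S} {τ : Ty S.Base} (t : Raw S Γ τ) : ∀ {Δ : Ctx S}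
    (ρ : Ren Γ Δ), (t.rename ρ).noms = t.noms := by
  induction t with
  | var x => intros; rfl
  | const c => intros; rfl
  | nom τ k => intros; rfl
  | app t s iht ihs => intro Δ ρ; simp only [Raw.rename, Raw.noms, iht, ihs]
  | lam t ih => intro Δ ρ; simp only [Raw.rename, Raw.noms, ih]

theorem Raw.notMem_noms_bind {Γ : Ctx S} {τ : Ty S.Base} (t : Raw S Γ τ) {n : Nominal S} :
    ∀ {Δ : Ctx S} {E : RawEnv Γ Δ}, (∀ τ x, n ∉ (E τ x).noms) → n ∉ (t.bind E).noms := by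
  induction t with
  | var x => intro Δ E h; exact h _ _
  | const c => intro Δ E h; exact id
  | nom τ k => intro Δ E h; exact h _ _
  | app t s iht ihs => intro Δ E h hn; exact hn.elim (iht h) (ihs h)
  | lam t ih =>
    intro Δ E h
    refine ih fun τ x => ?_
    rcases x with (_ | x) | k
    · exact id
    · simpa only [RawEnv.lift, Raw.noms_rename] using h _ _
    · simpa only [RawEnv.lift, Raw.noms_rename] using h _ _

theorem Raw.finite_noms {Γ : Ctx S} {τ : Ty S.Base} (t : Raw S Γ τ) : t.noms.Finite := by
  induction t with
  | var x => exact Set.finite_empty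
  | const c => exact Set.finite_empty
  | nom τ k => exact Set.finite_singleton _
  | app t s iht ihs => exact iht.union ihs
  | lam t ih => exact ih

end RawBind

-- Substitution, support and abstraction for terms modulo conversion.

noncomputable section TmBind

variable {S : Signature.{u}}

/-- Assignments of terms over `Δ` to the variables of `Γ` and to the nominal constants. -/
abbrev Env (Γ Δ : Ctx S) : Type u := ∀ τ : Ty S.Base, Var Γ τ ⊕ ℕ → Tm S Δ τ

/-- Simultaneous substitution for the variables and the nominal constants. -/
def Tm.bind {Γ Δ : Ctx S} {τ : Ty S.Base} (t : Tm S Γ τ) (E : Env Γ Δ) : Tm S Δ τ :=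
  Quotient.liftOn t (fun t => Tm.mk (t.bind (fun τ x => Quotient.out (E τ x))))
    (fun _ _ h => Quotient.sound (Conv.bind h _))

theorem Tm.mk_bind {Γ Δ : Ctx S} {τ : Ty S.Base} (t : Raw S Γ τ) (E : RawEnv Γ Δ) :
    (Tm.mk t).bind (fun τ x => Tm.mk (E τ x)) = Tm.mk (t.bind E) :=
  Quotient.sound (Conv.bind_right t fun τ x => Quotient.mk_out (s := convSetoid S Δ τ) (E τ x))

theorem Tm.exists_mk {Γ : Ctx S} {τ : Ty S.Base} (t : Tm S Γ τ) : ∃ r, Tm.mk r = t :=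
  Quotient.exists_rep t

theorem Env.exists_mk {Γ Δ : Ctx S} (E : Env Γ Δ) :
    ∃ R : RawEnv Γ Δ, (fun τ x => Tm.mk (R τ x)) = E := by
  choose R hR using fun τ x => Tm.exists_mk (E τ x)
  exact ⟨R, funext fun τ => funext fun x => hR τ x⟩

theorem Tm.bind_bind {Γ Δ Θ : Ctx S} {τ : Ty S.Base} (t : Tm S Γ τ) (E : Env Γ Δ)
    (E' : Env Δ Θ) : (t.bind E).bind E' = t.bind (fun τ x => (E τ x).bind E') := by
  obtain ⟨r, rfl⟩ := t.exists_mk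
  obtain ⟨R, rfl⟩ := E.exists_mk
  obtain ⟨R', rfl⟩ := E'.exists_mk
  simp only [Tm.mk_bind, Raw.bind_bind]

/-- Substitutions and permutations are both instances of `Tm.bind`, so most of their algebra reduces
to `Tm.bind_bind`. -/
theorem Tm.subst_eq_bind {Γ Δ : Ctx S} {τ : Ty S.Base} (t : Tm S Γ τ) (σ : Sub Γ Δ) :
    t.subst σ = t.bind (fun τ => Sum.elim (σ τ) (fun k => Tm.nom (τ, k))) := by
  obtain ⟨r, rfl⟩ := t.exists_mk
  choose R hR using fun τ x => Tm.exists_mk (σ τ x)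
  obtain rfl : (fun τ x => Tm.mk (R τ x)) = σ := funext fun τ => funext fun x => hR τ x
  rw [Tm.mk_subst, Raw.subst_eq_bind, ← Tm.mk_bind]
  congr 1
  funext τ x
  rcases x with x | k <;> rfl

theorem Tm.perm_eq_bind (π : NomPerm S) {Γ : Ctx S} {τ : Ty S.Base} (t : Tm S Γ τ) :
    t.perm π = t.bind (fun τ => Sum.elim Tm.var (fun k => Tm.nom (τ, π τ k))) := by
  obtain ⟨r, rfl⟩ := t.exists_mk
  have h : (Tm.mk r).perm π = Tm.mk (r.perm π) := rfl
  rw [h, Raw.perm_eq_bind, ← Tm.mk_bind]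
  congr 1
  funext τ x
  rcases x with x | k <;> rfl

@[simp]
theorem Tm.var_bind {Γ Δ : Ctx S} {τ : Ty S.Base} (x : Var Γ τ) (E : Env Γ Δ) :
    (Tm.var x).bind E = E τ (.inl x) := by
  obtain ⟨R, rfl⟩ := E.exists_mk
  exact Tm.mk_bind (.var x) R

@[simp]
theorem Tm.nom_bind {Γ Δ : Ctx S} (n : Nominal S) (E : Env Γ Δ) :
    (Tm.nom n : Tm S Γ n.1).bind E = E n.1 (.inr n.2) := by
  obtain ⟨R, rfl⟩ := E.exists_mk
  exact Tm.mk_bind (.nom n.1 n.2) R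

@[simp]
theorem Tm.app_bind {Γ Δ : Ctx S} {α β : Ty S.Base} (t : Tm S Γ (.arr α β)) (s : Tm S Γ α)
    (E : Env Γ Δ) : (t.app s).bind E = (t.bind E).app (s.bind E) := by
  obtain ⟨R, rfl⟩ := E.exists_mk
  obtain ⟨t, rfl⟩ := t.exists_mk
  obtain ⟨s, rfl⟩ := s.exists_mk
  rw [Tm.mk_bind, Tm.mk_bind]
  exact Tm.mk_bind (.app t s) R

@[simp]
theorem Tm.bind_id {Γ : Ctx S} {τ : Ty S.Base} (t : Tm S Γ τ) :
    t.bind (fun τ => Sum.elim Tm.var (fun k => Tm.nom (τ, k))) = t := by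
  rw [← Tm.subst_eq_bind]
  obtain ⟨t, rfl⟩ := t.exists_mk
  exact (Tm.mk_subst t (fun _ x => .var x)).trans (congrArg Tm.mk t.subst_var)

@[simp]
theorem Tm.subst_var {Γ Δ : Ctx S} {τ : Ty S.Base} (x : Var Γ τ) (σ : Sub Γ Δ) :
    (Tm.var x).subst σ = σ τ x := by
  simp [Tm.subst_eq_bind]

@[simp]
theorem Tm.subst_nom {Γ Δ : Ctx S} (n : Nominal S) (σ : Sub Γ Δ) :
    (Tm.nom n : Tm S Γ n.1).subst σ = Tm.nom n := by
  simp [Tm.subst_eq_bind]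

@[simp]
theorem Tm.subst_app {Γ Δ : Ctx S} {α β : Ty S.Base} (t : Tm S Γ (.arr α β)) (s : Tm S Γ α)
    (σ : Sub Γ Δ) : (t.app s).subst σ = (t.subst σ).app (s.subst σ) := by
  simp [Tm.subst_eq_bind]

theorem Tm.subst_id {Γ : Ctx S} {τ : Ty S.Base} (t : Tm S Γ τ) : t.subst (Sub.id Γ) = t := by
  rw [Tm.subst_eq_bind]
  exact t.bind_id

theorem Tm.subst_bind {Γ Δ Θ : Ctx S} {τ : Ty S.Base} (t : Tm S Γ τ) (σ : Sub Γ Δ)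
    (E : Env Δ Θ) : (t.subst σ).bind E =
      t.bind (fun τ => Sum.elim (fun x => (σ τ x).bind E) (fun k => E τ (.inr k))) := by
  rw [Tm.subst_eq_bind, Tm.bind_bind]
  congr 1
  funext τ x
  rcases x with x | k
  · rfl
  · exact Tm.nom_bind (τ, k) E

theorem Tm.subst_subst {Γ Δ Θ : Ctx S} {τ : Ty S.Base} (t : Tm S Γ τ) (σ : Sub Γ Δ)
    (σ' : Sub Δ Θ) : (t.subst σ).subst σ' = t.subst (fun τ x => (σ τ x).subst σ') := by
  simp only [Tm.subst_eq_bind _ σ', Tm.subst_bind, Sum.elim_inr]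
  rw [Tm.subst_eq_bind]

theorem Tm.perm_subst (π : NomPerm S) {Γ Δ : Ctx S} {τ : Ty S.Base} (t : Tm S Γ τ)
    (σ : Sub Γ Δ) : (t.subst σ).perm π = (t.perm π).subst (fun τ x => (σ τ x).perm π) := by
  obtain ⟨r, rfl⟩ := t.exists_mk
  choose R hR using fun τ x => Tm.exists_mk (σ τ x)
  obtain rfl : (fun τ x => Tm.mk (R τ x)) = σ := funext fun τ => funext fun x => hR τ x
  rw [Tm.mk_subst]
  exact (congrArg Tm.mk (r.perm_subst π R)).trans
    (Tm.mk_subst (r.perm π) (fun τ x => (R τ x).perm π)).symm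

@[simp]
theorem Tm.perm_nom (π : NomPerm S) {Γ : Ctx S} (τ : Ty S.Base) (k : ℕ) :
    (Tm.nom (τ, k) : Tm S Γ τ).perm π = Tm.nom (τ, π τ k) := rfl

theorem Tm.perm_perm (π π' : NomPerm S) {Γ : Ctx S} {τ : Ty S.Base} (t : Tm S Γ τ) :
    (t.perm π).perm π' = t.perm (fun τ => (π τ).trans (π' τ)) := by
  simp only [Tm.perm_eq_bind, Tm.bind_bind]
  congr 1
  funext τ x
  rcases x with x | k
  · simp
  · exact Tm.nom_bind (τ, π τ k) _

theorem Tm.perm_refl {Γ : Ctx S} {τ : Ty S.Base} (t : Tm S Γ τ) :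
    t.perm (fun _ => Equiv.refl ℕ) = t := by
  rw [Tm.perm_eq_bind]
  exact t.bind_id

@[simp]
theorem Tm.perm_symm_perm (π : NomPerm S) {Γ : Ctx S} {τ : Ty S.Base} (t : Tm S Γ τ) :
    (t.perm (fun τ => (π τ).symm)).perm π = t := by
  simpa [Tm.perm_perm] using t.perm_refl

@[simp]
theorem Tm.perm_perm_symm (π : NomPerm S) {Γ : Ctx S} {τ : Ty S.Base} (t : Tm S Γ τ) :
    (t.perm π).perm (fun τ => (π τ).symm) = t := by
  simpa [Tm.perm_perm] using t.perm_refl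

/-! ### Supports -/

theorem Tm.notMem_supp {Γ : Ctx S} {τ : Ty S.Base} {t : Tm S Γ τ} {n : Nominal S} :
    n ∉ t.supp ↔ ∃ r, Tm.mk r = t ∧ n ∉ r.noms := by
  simp [Tm.supp]

theorem Tm.finite_supp {Γ : Ctx S} {τ : Ty S.Base} (t : Tm S Γ τ) : t.supp.Finite := by
  obtain ⟨r, rfl⟩ := t.exists_mk
  exact r.finite_noms.subset fun n hn => hn r rfl

theorem Tm.mk_bind_congr {Γ Δ : Ctx S} {τ : Ty S.Base} (r : Raw S Γ τ) {E E' : Env Γ Δ}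
    (h : ∀ τ (x : Var Γ τ), r.Occurs x → E τ (.inl x) = E' τ (.inl x))
    (h' : ∀ τ k, (τ, k) ∈ r.noms → E τ (.inr k) = E' τ (.inr k)) :
    (Tm.mk r).bind E = (Tm.mk r).bind E' :=
  congrArg Tm.mk (r.bind_congr (fun τ x hx => congrArg Quotient.out (h τ x hx))
    (fun τ k hk => congrArg Quotient.out (h' τ k hk)))

/-- Each constant outside the support is missed by some representative, but perhaps by a different
one for each constant. Hence the assignment is changed at one constant of `A` at a time, each time
with a representative suited to that constant. -/
theorem Tm.bind_congr_of_finite {Γ Δ : Ctx S} {τ : Ty S.Base} (t : Tm S Γ τ)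
    {A : Set (Nominal S)} (hA : A.Finite) : Disjoint A t.supp → ∀ {E E' : Env Γ Δ},
    (∀ τ (x : Var Γ τ), E τ (.inl x) = E' τ (.inl x)) →
    (∀ τ k, (τ, k) ∉ A → E τ (.inr k) = E' τ (.inr k)) → t.bind E = t.bind E' := by
  classical
  induction A, hA using Set.Finite.induction_on with
  | empty =>
    intro _ E E' h h'
    congr 1
    funext τ x
    rcases x with x | k
    · exact h τ x
    · exact h' τ k (Set.notMem_empty _)
  | @insert n A _ _ ih =>
    intro hd E E' h h'
    rw [Set.disjoint_insert_left] at hd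
    obtain ⟨r, rfl, hr⟩ := Tm.notMem_supp.1 hd.1
    let E₁ : Env Γ Δ := fun τ =>
      Sum.elim (fun x => E τ (.inl x)) (fun k => if (τ, k) = n then E' τ (.inr k) else E τ (.inr k))
    have e : (Tm.mk r).bind E = (Tm.mk r).bind E₁ := by
      refine Tm.mk_bind_congr r (fun _ _ _ => rfl) fun τ k hk => ?_
      have : (τ, k) ≠ n := fun h => hr (h ▸ hk)
      simp [E₁, this]
    rw [e]
    refine ih hd.2 h fun τ k hk => ?_
    by_cases hn : (τ, k) = n
    · simp [E₁, hn]
    · simp only [E₁, Sum.elim_inr, if_neg hn]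
      exact h' τ k (by simp [hn, hk])

/-- A fixed representative contains only finitely many constants outside the support; these are
covered by the finite case, and constants absent from the representative can be reassigned freely.
-/
theorem Tm.bind_congr {Γ Δ : Ctx S} {τ : Ty S.Base} (t : Tm S Γ τ) {E E' : Env Γ Δ}
    (h : ∀ τ (x : Var Γ τ), E τ (.inl x) = E' τ (.inl x))
    (h' : ∀ τ k, (τ, k) ∈ t.supp → E τ (.inr k) = E' τ (.inr k)) : t.bind E = t.bind E' := by
  classical
  obtain ⟨r, rfl⟩ := t.exists_mk
  let E₁ : Env Γ Δ := fun τ => Sum.elim (fun x => E τ (.inl x))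
    (fun k => if (τ, k) ∈ r.noms then E τ (.inr k) else E' τ (.inr k))
  have e : (Tm.mk r).bind E = (Tm.mk r).bind E₁ :=
    Tm.mk_bind_congr r (fun _ _ _ => rfl) fun τ k hk => by simp [E₁, hk]
  rw [e]
  refine Tm.bind_congr_of_finite _ (r.finite_noms.sdiff (t := (Tm.mk r).supp))
    Set.disjoint_sdiff_left h fun τ k hk => ?_
  by_cases hr : (τ, k) ∈ r.noms
  · simp only [E₁, Sum.elim_inr, if_pos hr]
    exact h' τ k (by_contra fun hs => hk ⟨hr, hs⟩)
  · simp [E₁, hr]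

theorem Tm.subst_congr_of_not_occurs {Γ Δ : Ctx S} {τ : Ty S.Base} (t : Tm S Γ τ)
    {ζ : Ty S.Base} {z : Var Γ ζ} (hz : ¬ t.Occurs z) {σ σ' : Sub Γ Δ}
    (h : ∀ τ (x : Var Γ τ), (⟨τ, x⟩ : Σ τ, Var Γ τ) ≠ ⟨ζ, z⟩ → σ τ x = σ' τ x) :
    t.subst σ = t.subst σ' := by
  simp only [Tm.Occurs, not_forall] at hz
  obtain ⟨r, rfl, hr⟩ := hz
  rw [Tm.subst_eq_bind, Tm.subst_eq_bind]
  refine Tm.mk_bind_congr r (fun τ x hx => h τ x fun e => hr ?_) (fun _ _ _ => rfl)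
  cases e
  exact hx

theorem Tm.mem_supp_nom {Γ : Ctx S} {n m : Nominal S}
    (h : n ∈ (Tm.nom m : Tm S Γ m.1).supp) : n = m :=
  h (.nom m.1 m.2) rfl

theorem Tm.supp_var {Γ : Ctx S} {τ : Ty S.Base} (x : Var Γ τ) : (Tm.var x).supp = ∅ :=
  Set.eq_empty_of_forall_notMem fun _ h => h (.var x) rfl

theorem Tm.mem_supp_bind {Γ Δ : Ctx S} {τ : Ty S.Base} {t : Tm S Γ τ} {E : Env Γ Δ}
    {n : Nominal S} (h : n ∈ (t.bind E).supp) :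
    (∃ τ x, n ∈ (E τ (.inl x)).supp) ∨ ∃ τ k, (τ, k) ∈ t.supp ∧ n ∈ (E τ (.inr k)).supp := by
  classical
  by_contra! hc
  -- Values outside the support of `t` are irrelevant and are reset to a constant different from
  -- `n`; the index `n.2 + 1` ensures this at every type. Then every value has a representative free
  -- of `n`.
  let E₁ : Env Γ Δ := fun τ => Sum.elim (fun x => E τ (.inl x))
    (fun k => if (τ, k) ∈ t.supp then E τ (.inr k) else Tm.nom (τ, n.2 + 1))
  have e : t.bind E = t.bind E₁ :=
    Tm.bind_congr t (fun _ _ => rfl) fun τ k hk => by simp [E₁, hk]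
  have hE : ∀ τ x, n ∉ (E₁ τ x).supp := by
    intro τ x
    rcases x with x | k
    · exact hc.1 τ x
    · by_cases hk : (τ, k) ∈ t.supp
      · simpa [E₁, hk] using hc.2 τ k hk
      · simp only [E₁, Sum.elim_inr, if_neg hk]
        intro hn
        have := congrArg Prod.snd (Tm.mem_supp_nom hn)
        simp at this
  choose R hR hn using fun τ x => Tm.notMem_supp.1 (hE τ x)
  obtain ⟨r, rfl⟩ := t.exists_mk
  have e' : E₁ = fun τ x => Tm.mk (R τ x) := funext fun τ => funext fun x => (hR τ x).symm
  rw [e, e', Tm.mk_bind] at h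
  exact Raw.notMem_noms_bind r hn (h _ rfl)

theorem Tm.mem_supp_subst {Γ Δ : Ctx S} {τ : Ty S.Base} {t : Tm S Γ τ} {σ : Sub Γ Δ}
    {n : Nominal S} (h : n ∈ (t.subst σ).supp) : n ∈ t.supp ∨ n ∈ σ.supp := by
  rw [Tm.subst_eq_bind] at h
  rcases Tm.mem_supp_bind h with h | ⟨τ, k, hk, h⟩
  · exact .inr h
  · exact .inl (Tm.mem_supp_nom h ▸ hk)

theorem Tm.mem_supp_perm {π : NomPerm S} {Γ : Ctx S} {τ : Ty S.Base} {t : Tm S Γ τ}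
    {n : Nominal S} (h : n ∈ (t.perm π).supp) : ∃ m ∈ t.supp, n = (m.1, π m.1 m.2) := by
  rw [Tm.perm_eq_bind] at h
  rcases Tm.mem_supp_bind h with ⟨τ, x, h⟩ | ⟨τ, k, hk, h⟩
  · simp [Tm.supp_var] at h
  · exact ⟨_, hk, Tm.mem_supp_nom h⟩

theorem Tm.perm_eq_self {π : NomPerm S} {Γ : Ctx S} {τ : Ty S.Base} {t : Tm S Γ τ}
    (h : ∀ τ k, (τ, k) ∈ t.supp → π τ k = k) : t.perm π = t := by
  rw [Tm.perm_eq_bind]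
  conv_rhs => rw [← t.bind_id]
  exact t.bind_congr (fun _ _ => rfl) fun τ k hk => by simp only [Sum.elim_inr]; rw [h τ k hk]

theorem finite_sigma_var (Γ : Ctx S) : Finite (Σ τ : Ty S.Base, Var Γ τ) := by
  induction Γ with
  | nil => exact @Finite.of_subsingleton _ ⟨fun x => nomatch x.2⟩
  | cons α Γ ih =>
    refine Finite.of_surjective
      (fun o : Option (Σ τ : Ty S.Base, Var Γ τ) =>
        (o.elim ⟨α, Var.zero⟩ fun x => ⟨x.1, x.2.succ⟩ : Σ τ : Ty S.Base, Var (α :: Γ) τ)) ?_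
    rintro ⟨τ, _ | x⟩
    · exact ⟨none, rfl⟩
    · exact ⟨some ⟨_, x⟩, rfl⟩

theorem Sub.finite_supp {Γ Δ : Ctx S} (σ : Sub Γ Δ) : σ.supp.Finite := by
  have := finite_sigma_var Γ
  have h : σ.supp = ⋃ x : Σ τ : Ty S.Base, Var Γ τ, (σ x.1 x.2).supp := by
    ext n
    simp [Sub.supp, Sigma.exists]
  rw [h]
  exact Set.finite_iUnion fun x => Tm.finite_supp _

theorem Sub.supp_id (Γ : Ctx S) : (Sub.id Γ).supp = ∅ := by
  simp [Sub.supp, Sub.id, Tm.supp_var]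

theorem Sub.supp_wk (Γ : Ctx S) (α : Ty S.Base) : (Sub.wk Γ α).supp = ∅ := by
  simp [Sub.supp, Sub.wk, Tm.supp_var]

theorem Sub.mem_supp_lift {Γ Δ : Ctx S} {σ : Sub Γ Δ} {α : Ty S.Base} {n : Nominal S}
    (h : n ∈ (σ.lift α).supp) : n ∈ σ.supp := by
  obtain ⟨τ, x, h⟩ := h
  cases x with
  | zero => simp [Sub.lift, Tm.supp_var] at h
  | succ x =>
    rcases Tm.mem_supp_subst h with h | h
    · exact ⟨_, _, h⟩
    · simp [Sub.supp_wk] at h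

theorem Sub.mem_supp_cons {Γ Δ : Ctx S} {σ : Sub Γ Δ} {α : Ty S.Base} {t : Tm S Δ α}
    {n : Nominal S} (h : n ∈ (Sub.cons t σ).supp) : n ∈ t.supp ∨ n ∈ σ.supp := by
  obtain ⟨τ, x, h⟩ := h
  cases x with
  | zero => exact .inl h
  | succ x => exact .inr ⟨_, _, h⟩

/-! ### Instantiation and abstraction -/

theorem Sub.cons_comp {Γ Δ Θ : Ctx S} {α : Ty S.Base} (t : Tm S Δ α) (σ : Sub Γ Δ)
    (σ' : Sub Δ Θ) : (fun τ x => (Sub.cons t σ τ x).subst σ') =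
      Sub.cons (t.subst σ') (fun τ x => (σ τ x).subst σ') := by
  funext τ x
  cases x <;> rfl

theorem Sub.lift_comp_cons {Γ Δ Θ : Ctx S} {α : Ty S.Base} (σ : Sub Γ Δ) (t : Tm S Θ α)
    (σ' : Sub Δ Θ) : (fun τ x => (σ.lift α τ x).subst (Sub.cons t σ')) =
      Sub.cons t (fun τ x => (σ τ x).subst σ') := by
  funext τ x
  cases x with
  | zero => exact Tm.subst_var _ _
  | succ x =>
    simp only [Sub.lift, Tm.subst_subst, Sub.wk, Tm.subst_var]
    rfl

theorem Sub.lift_comp_lift {Γ Δ Θ : Ctx S} (α : Ty S.Base) (σ : Sub Γ Δ) (σ' : Sub Δ Θ) :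
    (fun τ x => (σ.lift α τ x).subst (σ'.lift α)) =
      Sub.lift (fun τ x => (σ τ x).subst σ') α := by
  funext τ x
  cases x with
  | zero => exact Tm.subst_var _ _
  | succ x =>
    simp only [Sub.lift, Tm.subst_subst, Sub.wk, Tm.subst_var]

theorem Tm.appNoms_subst {Γ Δ : Ctx S} {τ : Ty S.Base} (ns : List (Nominal S)) :
    ∀ (t : Tm S Γ (raiseTy ns τ)) (σ : Sub Γ Δ),
      (Tm.appNoms ns t).subst σ = Tm.appNoms ns (t.subst σ) := by
  induction ns with
  | nil => intros; rfl
  | cons n ns ih =>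
    intro t σ
    simp only [Tm.appNoms]
    rw [ih]
    exact congrArg _ ((Tm.subst_app t (Tm.nom n) σ).trans
      (congrArg (Tm.app (t.subst σ)) (Tm.subst_nom n σ)))

/-- The constant is replaced by a fresh variable, which is then bound by `λ`; `β`-reduction puts the
constant back. -/
theorem Tm.exists_abs {Γ : Ctx S} {α β : Ty S.Base} (t : Tm S Γ β) (k : ℕ) :
    ∃ s : Tm S Γ (.arr α β), s.app (Tm.nom (α, k)) = t ∧
      ∀ n ∈ s.supp, n ∈ t.supp ∧ n ≠ (α, k) := by
  classical
  let E : Env Γ (α :: Γ) := fun τ => Sum.elim (fun x => Tm.var x.succ)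
    (fun j => if h : α = τ ∧ j = k then h.1 ▸ Tm.var Var.zero else Tm.nom (τ, j))
  obtain ⟨r, hr⟩ := (t.bind E).exists_mk
  refine ⟨Tm.mk (.lam r), ?_, ?_⟩
  · have h₁ : (Tm.mk (.lam r)).app (Tm.nom (α, k)) = (Tm.mk r).subst (Sub.inst (Tm.nom (α, k))) := by
      have h₂ : (Sub.inst (Tm.nom (α, k)) : Sub (α :: Γ) Γ) =
          fun τ x => Tm.mk (RawSub.inst (.nom α k) τ x) := by
        funext τ x
        cases x <;> rfl
      rw [h₂, Tm.mk_subst]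
      exact Quotient.sound (Conv.beta r (.nom α k))
    rw [h₁, hr, Tm.subst_eq_bind, Tm.bind_bind]
    conv_rhs => rw [← t.bind_id]
    congr 1
    funext τ x
    rcases x with x | j
    · simp [E, Sub.inst, Sub.cons, Sub.id]
    · by_cases h : α = τ ∧ j = k
      · obtain ⟨rfl, rfl⟩ := h
        simp [E, Sub.inst, Sub.cons]
      · simp only [E, Sum.elim_inr, dif_neg h]
        exact Tm.nom_bind (τ, j) _
  · intro n hn
    have hn' : n ∈ (t.bind E).supp := by
      intro r' hr'
      -- Every representative of the body yields one of the abstraction with the same nominal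
      -- constants.
      exact hn (.lam r') (Quotient.sound (Conv.lam (Quotient.exact (hr'.trans hr.symm))))
    rcases Tm.mem_supp_bind hn' with ⟨τ, x, h⟩ | ⟨τ, j, hj, h⟩
    · simp [E, Tm.supp_var] at h
    · by_cases hc : α = τ ∧ j = k
      · obtain ⟨rfl, rfl⟩ := hc
        simp [E, Tm.supp_var] at h
      · simp only [E, Sum.elim_inr, dif_neg hc] at h
        obtain rfl := Tm.mem_supp_nom h
        refine ⟨hj, fun e => hc ?_⟩
        cases e
        exact ⟨rfl, rfl⟩

theorem Tm.exists_absNoms {Γ : Ctx S} {α : Ty S.Base} (t : Tm S Γ α) (ns : List (Nominal S)) :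
    ∃ s : Tm S Γ (raiseTy ns α), Tm.appNoms ns s = t ∧ ∀ n ∈ s.supp, n ∈ t.supp ∧ n ∉ ns := by
  induction ns with
  | nil => exact ⟨t, rfl, fun n hn => ⟨hn, by simp⟩⟩
  | cons m ns ih =>
    obtain ⟨s, hs, h⟩ := ih
    obtain ⟨s', hs', h'⟩ := Tm.exists_abs (α := m.1) s m.2
    refine ⟨s', ?_, fun n hn => ?_⟩
    · simp only [Tm.appNoms]
      rw [← hs]
      exact congrArg _ hs'
    · obtain ⟨h₁, h₂⟩ := h' n hn
      exact ⟨(h n h₁).1, by simp [(h n h₁).2, h₂]⟩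

/-- Finitely many nominal constants can be replaced by variables, and conversely. -/
theorem exists_nominals_as_variables (l : List (Nominal S)) (hl : l.Nodup) :
    ∃ (Z : Ctx S) (R : ∀ τ : Ty S.Base, ℕ → Tm S Z τ) (b : Sub Z []),
      (∀ τ k, (R τ k).subst b = Tm.nom (τ, k)) ∧ (∀ τ k, (τ, k) ∈ l → (R τ k).supp = ∅) ∧
      (∀ τ k, (τ, k) ∉ l → R τ k = Tm.nom (τ, k)) ∧ (∀ n ∈ b.supp, n ∈ l) ∧
      ∀ (ζ : Ty S.Base) (z : Var Z ζ), ∃ b' : Sub Z [],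
        (∀ τ x, (⟨τ, x⟩ : Σ τ, Var Z τ) ≠ ⟨ζ, z⟩ → b τ x = b' τ x) ∧
        ∃ n ∈ l, n ∉ b'.supp := by
  classical
  induction l with
  | nil =>
    refine ⟨[], fun τ k => Tm.nom (τ, k), Sub.id [], ?_, by simp, by simp, ?_, ?_⟩
    · exact fun τ k => Tm.subst_nom (τ, k) _
    · simp [Sub.supp_id]
    · intro ζ z
      nomatch z
  | cons m l ih =>
    rw [List.nodup_cons] at hl
    obtain ⟨Z, R, b, h₁, h₂, h₃, h₄, h₅⟩ := ih hl.2
    refine ⟨m.1 :: Z, fun τ k => if h : m.1 = τ ∧ m.2 = k then h.1 ▸ Tm.var Var.zero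
      else (R τ k).subst (Sub.wk Z m.1), Sub.cons (Tm.nom m) b, ?_, ?_, ?_, ?_, ?_⟩
    · intro τ k
      by_cases h : m.1 = τ ∧ m.2 = k
      · obtain ⟨τ', k'⟩ := m
        obtain ⟨rfl, rfl⟩ := h
        simp [Sub.cons]
      · simp only [dif_neg h]
        rw [Tm.subst_subst, ← h₁ τ k]
        congr 1
        funext τ x
        simp [Sub.wk, Sub.cons]
    · intro τ k hk
      by_cases h : m.1 = τ ∧ m.2 = k
      · obtain ⟨τ', k'⟩ := m
        obtain ⟨rfl, rfl⟩ := h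
        simp [Tm.supp_var]
      · simp only [dif_neg h]
        have hk' : (τ, k) ∈ l := by
          rcases List.mem_cons.1 hk with e | hk
          · subst e
            exact absurd ⟨rfl, rfl⟩ h
          · exact hk
        refine Set.eq_empty_of_forall_notMem fun n hn => ?_
        rcases Tm.mem_supp_subst hn with hn | hn
        · simp [h₂ τ k hk'] at hn
        · simp [Sub.supp_wk] at hn
    · intro τ k hk
      rw [List.mem_cons, not_or] at hk
      have h : ¬ (m.1 = τ ∧ m.2 = k) := fun h => hk.1 (Prod.ext h.1.symm h.2.symm)
      simp only [dif_neg h]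
      rw [h₃ τ k hk.2]
      exact Tm.subst_nom (τ, k) _
    · intro n hn
      rcases Sub.mem_supp_cons hn with hn | hn
      · simp [Tm.mem_supp_nom hn]
      · exact List.mem_cons_of_mem _ (h₄ n hn)
    · intro ζ z
      cases z with
      | zero =>
        -- Sending the new variable to another constant of its type removes `m` from the support,
        -- because `m` is not in `l`.
        refine ⟨Sub.cons (Tm.nom (m.1, m.2 + 1)) b, ?_, m, by simp, ?_⟩
        · intro τ x hx
          cases x with
          | zero => exact absurd rfl hx
          | succ x => rfl
        · intro hm
          rcases Sub.mem_supp_cons hm with hm | hm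
          · have := congrArg Prod.snd (Tm.mem_supp_nom hm)
            simp at this
          · exact hl.1 (h₄ m hm)
      | succ z =>
        obtain ⟨b', hb, n, hn, hn'⟩ := h₅ _ z
        refine ⟨Sub.cons (Tm.nom m) b', ?_, n, by simp [hn], ?_⟩
        · intro τ x hx
          cases x with
          | zero => rfl
          | succ x =>
            refine hb _ x fun e => hx ?_
            cases e
            rfl
        · intro hm
          rcases Sub.mem_supp_cons hm with hm | hm
          · exact hl.1 (Tm.mem_supp_nom hm ▸ hn)
          · exact hn' hm

/-- A permutation of nominal constants that fixes `F` and moves `R` away from `A`. -/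
theorem exists_nomPerm {F R A : Set (Nominal S)} (hF : F.Finite) (hR : R.Finite) (hA : A.Finite)
    (hd : Disjoint R F) : ∃ π : NomPerm S, (∀ τ k, (τ, k) ∈ F → π τ k = k) ∧
      ∀ τ k, (τ, k) ∈ R → (τ, π τ k) ∉ A := by
  classical
  obtain ⟨N, hN⟩ := ((hF.union hR).union hA).image Prod.snd |>.bddAbove
  have hb : ∀ n ∈ F ∪ R ∪ A, n.2 < N + 1 := fun n hn =>
    Nat.lt_succ_of_le (hN (Set.mem_image_of_mem _ hn))
  have hbR : ∀ {τ k}, (τ, k) ∈ R → k < N + 1 := fun h => hb _ (.inl (.inr h))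
  -- The involution exchanges `R` with its shift by `N + 1`. As `N` bounds all indices in `F`, `R`
  -- and `A`, the shifted copy meets none of them.
  let f : Ty S.Base → ℕ → ℕ := fun τ k => if (τ, k) ∈ R then k + (N + 1) else
    if N + 1 ≤ k ∧ (τ, k - (N + 1)) ∈ R then k - (N + 1) else k
  have hf : ∀ τ, Function.Involutive (f τ) := by
    intro τ k
    by_cases h : (τ, k) ∈ R
    · have h' : (τ, k + (N + 1)) ∉ R := fun h' => by have := hbR h'; omega
      simp only [f, if_pos h, if_neg h']
      rw [if_pos ⟨by omega, by simpa using h⟩]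
      omega
    · by_cases h' : N + 1 ≤ k ∧ (τ, k - (N + 1)) ∈ R
      · simp only [f, if_neg h, if_pos h', if_pos h'.2]
        omega
      · simp only [f, if_neg h, if_neg h']
  refine ⟨fun τ => (hf τ).toPerm, fun τ k hk => ?_, fun τ k hk hA => ?_⟩
  · have h : (τ, k) ∉ R := fun h => Set.disjoint_left.1 hd h hk
    have h' : ¬ (N + 1 ≤ k ∧ (τ, k - (N + 1)) ∈ R) := fun h' => by
      have := hb _ (.inl (.inl hk))
      simp only at this
      omega
    change f τ k = k
    simp only [f, if_neg h, if_neg h']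
  · have h := hb _ (.inr hA)
    change f τ k < N + 1 at h
    simp only [f, if_pos hk] at h
    omega

end TmBind

-- Substitution, support and permutation for formulas.

noncomputable section FormLemmas

variable {S : Signature.{u}}

theorem Form.subst_subst {Γ : Ctx S} (F : Form S Γ) : ∀ {Δ Θ : Ctx S} (σ : Sub Γ Δ)
    (σ' : Sub Δ Θ), (F.subst σ).subst σ' = F.subst (fun τ x => (σ τ x).subst σ') := by
  induction F with
  | atom p ts => intros; simp only [Form.subst, Tm.subst_subst]
  | bot => intros; rfl
  | top => intros; rfl
  | and A B ihA ihB => intros; simp only [Form.subst, ihA, ihB]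
  | or A B ihA ihB => intros; simp only [Form.subst, ihA, ihB]
  | imp A B ihA ihB => intros; simp only [Form.subst, ihA, ihB]
  | all α C ih => intros; simp only [Form.subst, ih, Sub.lift_comp_lift]
  | ex α C ih => intros; simp only [Form.subst, ih, Sub.lift_comp_lift]
  | nabla α C ih => intros; simp only [Form.subst, ih, Sub.lift_comp_lift]

theorem Form.subst_lift_inst {Γ Δ : Ctx S} {α : Ty S.Base} (C : Form S (α :: Γ)) (σ : Sub Γ Δ)
    (t : Tm S Δ α) : (C.subst (σ.lift α)).subst (Sub.inst t) = C.subst (Sub.cons t σ) := by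
  rw [Form.subst_subst, Sub.inst, Sub.lift_comp_cons]
  simp only [Tm.subst_id]

theorem Form.finite_supp {Γ : Ctx S} (F : Form S Γ) : F.supp.Finite := by
  induction F with
  | atom p ts => exact Sub.finite_supp ts
  | bot => exact Set.finite_empty
  | top => exact Set.finite_empty
  | and A B ihA ihB => exact ihA.union ihB
  | or A B ihA ihB => exact ihA.union ihB
  | imp A B ihA ihB => exact ihA.union ihB
  | all α C ih => exact ih
  | ex α C ih => exact ih
  | nabla α C ih => exact ih

theorem Form.mem_supp_subst {Γ : Ctx S} {F : Form S Γ} {n : Nominal S} : ∀ {Δ : Ctx S}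
    {σ : Sub Γ Δ}, n ∈ (F.subst σ).supp → n ∈ F.supp ∨ n ∈ σ.supp := by
  induction F with
  | atom p ts =>
    rintro Δ σ ⟨τ, x, h⟩
    exact (Tm.mem_supp_subst h).imp_left fun h => ⟨τ, x, h⟩
  | bot => exact fun h => h.elim
  | top => exact fun h => h.elim
  | and A B ihA ihB =>
    exact fun h => h.elim (fun h => (ihA h).imp_left .inl) (fun h => (ihB h).imp_left .inr)
  | or A B ihA ihB =>
    exact fun h => h.elim (fun h => (ihA h).imp_left .inl) (fun h => (ihB h).imp_left .inr)
  | imp A B ihA ihB =>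
    exact fun h => h.elim (fun h => (ihA h).imp_left .inl) (fun h => (ihB h).imp_left .inr)
  | all α C ih => exact fun h => (ih h).imp_right Sub.mem_supp_lift
  | ex α C ih => exact fun h => (ih h).imp_right Sub.mem_supp_lift
  | nabla α C ih => exact fun h => (ih h).imp_right Sub.mem_supp_lift

theorem Form.mem_supp_predSubst {f : ∀ q : S.Pred, Form S (S.arity q)} {n : Nominal S}
    {Γ : Ctx S} {F : Form S Γ} : n ∈ (F.predSubst f).supp → n ∈ F.supp ∨ ∃ q, n ∈ (f q).supp := by
  induction F with
  | atom p ts => exact fun h => (Form.mem_supp_subst h).symm.imp_right fun h => ⟨p, h⟩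
  | bot => exact fun h => h.elim
  | top => exact fun h => h.elim
  | and A B ihA ihB =>
    exact fun h => h.elim (fun h => (ihA h).imp_left .inl) (fun h => (ihB h).imp_left .inr)
  | or A B ihA ihB =>
    exact fun h => h.elim (fun h => (ihA h).imp_left .inl) (fun h => (ihB h).imp_left .inr)
  | imp A B ihA ihB =>
    exact fun h => h.elim (fun h => (ihA h).imp_left .inl) (fun h => (ihB h).imp_left .inr)
  | all α C ih => exact ih
  | ex α C ih => exact ih
  | nabla α C ih => exact ih

theorem Form.supp_replacePred {Γ : Ctx S} {F : Form S Γ} {p : S.Pred} {J : Form S (S.arity p)}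
    (hF : F.supp = ∅) (hJ : J.supp = ∅) : (F.replacePred p J).supp = ∅ := by
  classical
  refine Set.eq_empty_of_forall_notMem fun n hn => ?_
  rcases Form.mem_supp_predSubst hn with h | ⟨q, h⟩
  · simp [hF] at h
  · by_cases hq : q = p
    · subst hq
      simp [hJ] at h
    · rw [Function.update_of_ne hq] at h
      exact (Set.ext_iff.1 (Sub.supp_id (S.arity q)) n).1 h

theorem Form.perm_eq_self {π : NomPerm S} {Γ : Ctx S} {F : Form S Γ}
    (h : ∀ τ k, (τ, k) ∈ F.supp → π τ k = k) : F.perm π = F := by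
  induction F with
  | atom p ts =>
    simp only [Form.perm]
    congr 1
    funext τ x
    exact Tm.perm_eq_self fun τ' k hk => h τ' k ⟨τ, x, hk⟩
  | bot => rfl
  | top => rfl
  | and A B ihA ihB =>
    simp only [Form.perm]
    rw [ihA fun τ k hk => h τ k (.inl hk), ihB fun τ k hk => h τ k (.inr hk)]
  | or A B ihA ihB =>
    simp only [Form.perm]
    rw [ihA fun τ k hk => h τ k (.inl hk), ihB fun τ k hk => h τ k (.inr hk)]
  | imp A B ihA ihB =>
    simp only [Form.perm]
    rw [ihA fun τ k hk => h τ k (.inl hk), ihB fun τ k hk => h τ k (.inr hk)]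
  | all α C ih => simp only [Form.perm]; rw [ih h]
  | ex α C ih => simp only [Form.perm]; rw [ih h]
  | nabla α C ih => simp only [Form.perm]; rw [ih h]

end FormLemmas

-- Truth of formulas in an interpretation of the predicates.

section Truth

variable {S : Signature.{u}}

/-- Interpretations of the predicate constants, as sets of tuples of ground terms. -/
abbrev Interp (S : Signature.{u}) : Type u := ∀ p : S.Pred, Sub (S.arity p) [] → Prop

/-- Truth of a formula under a grounding substitution, where the atoms in the antecedents of
implications are interpreted by `N` and the other ones by `M`. -/
def Form.True (N : Interp S) : Interp S → {Γ : Ctx S} → Form S Γ → Sub Γ [] → Prop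
  | M, _, .atom p ts, ρ => M p (fun τ x => (ts τ x).subst ρ)
  | _, _, .bot, _ => False
  | _, _, .top, _ => _root_.True
  | M, _, .and A B, ρ => A.True N M ρ ∧ B.True N M ρ
  | M, _, .or A B, ρ => A.True N M ρ ∨ B.True N M ρ
  -- The whole antecedent is read by `N`, including its own positive parts, so that `M` is used only
  -- in monotone positions.
  | M, _, .imp A B, ρ => A.True N N ρ → B.True N M ρ
  | M, _, .all _ C, ρ => ∀ t, C.True N M (Sub.cons t ρ)
  | M, _, .ex _ C, ρ => ∃ t, C.True N M (Sub.cons t ρ)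
  | M, _, .nabla α C, ρ => ∀ᶠ k in Filter.cofinite, C.True N M (Sub.cons (Tm.nom (α, k)) ρ)

theorem Form.True.mono {N M M' : Interp S} (h : M ≤ M') {Γ : Ctx S} {F : Form S Γ} :
    ∀ {ρ : Sub Γ []}, F.True N M ρ → F.True N M' ρ := by
  induction F with
  | atom p ts => exact h p _
  | bot => exact id
  | top => exact id
  | and A B ihA ihB => exact And.imp ihA ihB
  | or A B ihA ihB => exact Or.imp ihA ihB
  | imp A B ihA ihB => exact fun hi hA => ihB (hi hA)
  | all α C ih => exact fun hC t => ih (hC t)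
  | ex α C ih => exact fun ⟨t, hC⟩ => ⟨t, ih hC⟩
  | nabla α C ih => exact fun hC => Filter.Eventually.mono hC fun k hC => ih hC

theorem Form.true_subst {N : Interp S} {Γ : Ctx S} {F : Form S Γ} : ∀ {M : Interp S} {Δ : Ctx S}
    {σ : Sub Γ Δ} {ρ : Sub Δ []},
    (F.subst σ).True N M ρ ↔ F.True N M (fun τ x => (σ τ x).subst ρ) := by
  induction F with
  | atom p ts => intros; simp only [Form.subst, Form.True, Tm.subst_subst]
  | bot => intros; rfl
  | top => intros; rfl
  | and A B ihA ihB => intros; simp only [Form.subst, Form.True, ihA, ihB]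
  | or A B ihA ihB => intros; simp only [Form.subst, Form.True, ihA, ihB]
  | imp A B ihA ihB => intros; simp only [Form.subst, Form.True, ihA, ihB]
  | all α C ih => intros; simp only [Form.subst, Form.True, ih, Sub.lift_comp_cons]
  | ex α C ih => intros; simp only [Form.subst, Form.True, ih, Sub.lift_comp_cons]
  | nabla α C ih => intros; simp only [Form.subst, Form.True, ih, Sub.lift_comp_cons]

theorem Form.true_predSubst {N : Interp S} {f : ∀ q : S.Pred, Form S (S.arity q)} {Γ : Ctx S}
    {F : Form S Γ} : ∀ {ρ : Sub Γ []}, (F.predSubst f).True N N ρ ↔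
      F.True (fun q us => (f q).True N N us) (fun q us => (f q).True N N us) ρ := by
  induction F with
  | atom p ts => exact Form.true_subst
  | bot => intros; rfl
  | top => intros; rfl
  | and A B ihA ihB => intros; simp only [Form.predSubst, Form.True, ihA, ihB]
  | or A B ihA ihB => intros; simp only [Form.predSubst, Form.True, ihA, ihB]
  | imp A B ihA ihB => intros; simp only [Form.predSubst, Form.True, ihA, ihB]
  | all α C ih => intros; simp only [Form.predSubst, Form.True, ih]
  | ex α C ih => intros; simp only [Form.predSubst, Form.True, ih]
  | nabla α C ih => intros; simp only [Form.predSubst, Form.True, ih]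

/-- The action of a permutation of the nominal constants on interpretations. -/
def Interp.perm (π : NomPerm S) (M : Interp S) : Interp S :=
  fun p ts => M p (fun τ x => (ts τ x).perm π)

theorem Sub.perm_cons (π : NomPerm S) {Γ Δ : Ctx S} {α : Ty S.Base} (t : Tm S Δ α)
    (σ : Sub Γ Δ) : (fun τ x => (Sub.cons t σ τ x).perm π) =
      Sub.cons (t.perm π) (fun τ x => (σ τ x).perm π) := by
  funext τ x
  cases x <;> rfl

/-- A permutation acts bijectively on ground terms and on the nominal constants of each type, so it
preserves the ranges of `∀` and `∃` and the cofinite filter in `∇`. -/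
theorem Form.true_perm (π : NomPerm S) {N : Interp S} {Γ : Ctx S} {F : Form S Γ} :
    ∀ {M : Interp S} {ρ : Sub Γ []}, F.True (N.perm π) (M.perm π) ρ ↔
      (F.perm π).True N M (fun τ x => (ρ τ x).perm π) := by
  induction F with
  | atom p ts => intros; simp only [Form.perm, Form.True, Interp.perm, Tm.perm_subst]
  | bot => intros; rfl
  | top => intros; rfl
  | and A B ihA ihB => intros; simp only [Form.perm, Form.True, ihA, ihB]
  | or A B ihA ihB => intros; simp only [Form.perm, Form.True, ihA, ihB]
  | imp A B ihA ihB => intros; simp only [Form.perm, Form.True, ihA, ihB]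
  | all α C ih =>
    intro M ρ
    simp only [Form.perm, Form.True, ih, Sub.perm_cons]
    exact ⟨fun h t => by simpa using h (t.perm (fun τ => (π τ).symm)), fun h t => h _⟩
  | ex α C ih =>
    intro M ρ
    simp only [Form.perm, Form.True, ih, Sub.perm_cons]
    exact ⟨fun ⟨t, h⟩ => ⟨_, h⟩, fun ⟨t, h⟩ => ⟨t.perm (fun τ => (π τ).symm), by simpa using h⟩⟩
  | nabla α C ih =>
    intro M ρ
    simp only [Form.perm, Form.True, ih, Sub.perm_cons, Tm.perm_nom]
    constructor
    · intro h
      have := (π α).symm.injective.tendsto_cofinite.eventually h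
      exact this.mono fun k hk => by rwa [Equiv.apply_symm_apply] at hk
    · intro h
      exact (π α).injective.tendsto_cofinite.eventually h

end Truth

/-! ### The model given by the definitions -/

section Model

variable {S : Signature.{u}} (D : Set (Clause S)) (I : IndDefs S)

/-- One step of unfolding the definitions and the inductive definitions. -/
def unfold (N M : Interp S) : Interp S := fun p ts =>
  (I p = none ∧ ∃ c ∈ D, ∃ σ : Sub c.ctx [], c.head.subst σ = .atom p ts ∧ c.body.True N M σ) ∨
    ∃ B, I p = some B ∧ B.True N M ts

variable {D I}

theorem unfold_mono {N M M' : Interp S} (h : M ≤ M') : unfold D I N M ≤ unfold D I N M' := by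
  rintro p ts (⟨h₁, c, hc, σ, h₂, h₃⟩ | ⟨B, h₁, h₂⟩)
  · exact .inl ⟨h₁, c, hc, σ, h₂, h₃.mono h⟩
  · exact .inr ⟨B, h₁, h₂.mono h⟩

variable (D I) in
/-- The least interpretation closed under unfolding, for fixed truth values of antecedents. -/
def least (N : Interp S) : Interp S := fun p ts => ∀ X : Interp S, unfold D I N X ≤ X → X p ts

theorem least_le {N X : Interp S} (h : unfold D I N X ≤ X) : least D I N ≤ X :=
  fun _ _ hl => hl X h

theorem unfold_least (N : Interp S) : unfold D I N (least D I N) ≤ least D I N :=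
  fun p ts h _ hX => hX p ts (unfold_mono (least_le hX) p ts h)

theorem least_le_unfold (N : Interp S) : least D I N ≤ unfold D I N (least D I N) :=
  least_le (unfold_mono (unfold_least N))

/-- Clauses contain no nominal constants, so permuting an instance of a clause gives an instance of
the same clause. -/
theorem unfold_perm_le (hD : ValidDefs D) (hI : ValidInd D I) (π : NomPerm S) (N M : Interp S) :
    unfold D I (N.perm π) (M.perm π) ≤ (unfold D I N M).perm π := by
  have hp : ∀ {Γ : Ctx S} {F : Form S Γ}, F.supp = ∅ → F.perm π = F := fun h =>
    Form.perm_eq_self fun τ k hk => by simp [h] at hk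
  rintro p ts (⟨h₁, c, hc, σ, h₂, h₃⟩ | ⟨B, h₁, h₂⟩)
  · refine .inl ⟨h₁, c, hc, fun τ x => (σ τ x).perm π, ?_, ?_⟩
    · have h := congrArg (Form.perm π) h₂
      simp only [Clause.head, Form.subst, Form.perm, Tm.perm_subst] at h
      simp only [Clause.head, Form.subst]
      rw [← h]
      have := hp (hD c hc).1
      simp only [Clause.head, Form.perm, Form.atom.injEq, heq_eq_eq, true_and] at this
      have h' : ∀ τ x, (c.args τ x).perm π = c.args τ x := fun τ x =>
        congrFun (congrFun this τ) x
      simp only [h']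
    · rw [Form.true_perm, hp (hD c hc).2.1] at h₃
      exact h₃
  · refine .inr ⟨B, h₁, ?_⟩
    rw [Form.true_perm, hp (hI p B h₁).1] at h₂
    exact h₂

theorem Interp.perm_symm_perm (π : NomPerm S) (M : Interp S) :
    (M.perm (fun τ => (π τ).symm)).perm π = M := by
  funext p ts
  simp [Interp.perm]

theorem Interp.perm_perm_symm (π : NomPerm S) (M : Interp S) :
    (M.perm π).perm (fun τ => (π τ).symm) = M := by
  funext p ts
  simp [Interp.perm]

theorem Interp.perm_mono (π : NomPerm S) {M M' : Interp S} (h : M ≤ M') : M.perm π ≤ M'.perm π :=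
  fun _ _ => h _ _

theorem least_perm (hD : ValidDefs D) (hI : ValidInd D I) (π : NomPerm S) (N : Interp S) :
    least D I (N.perm π) = (least D I N).perm π := by
  refine le_antisymm (least_le ?_) ?_
  · exact (unfold_perm_le hD hI π _ _).trans (Interp.perm_mono π (unfold_least N))
  -- The reverse inclusion is the closure argument for the inverse permutation.
  · have h : least D I N ≤ (least D I (N.perm π)).perm (fun τ => (π τ).symm) := by
      refine least_le ?_
      have h₁ := unfold_perm_le hD hI (fun τ => (π τ).symm) (N.perm π) (least D I (N.perm π))
      rw [Interp.perm_perm_symm] at h₁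
      exact h₁.trans (Interp.perm_mono _ (unfold_least _))
    have h₂ := Interp.perm_mono π h
    rwa [Interp.perm_symm_perm] at h₂

/-! #### Levels -/

variable {lvl : Form S [] → Ordinal.{v}}

/-- Stated for cofinitely many constants to match the truth condition of `∇`; the exceptions are the
finitely many constants in the support of the instance. -/
theorem IsLevel.subst_lift_nom (hlvl : IsLevel lvl) {Γ : Ctx S} {α : Ty S.Base}
    (C : Form S (α :: Γ)) (ρ : Sub Γ []) : ∀ᶠ k in Filter.cofinite,
      lvl (C.subst (Sub.cons (Tm.nom (α, k)) ρ)) = lvl ((Form.nabla α C).subst ρ) := by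
  have hf : {k | (α, k) ∈ (C.subst (ρ.lift α)).supp}.Finite :=
    (Form.finite_supp _).preimage (Prod.mk_right_injective α).injOn
  filter_upwards [hf.compl_mem_cofinite] with k hk
  rw [← Form.subst_lift_inst]
  exact (hlvl.nabla α (C.subst (ρ.lift α)) k hk).symm

theorem IsLevel.le_all (hlvl : IsLevel lvl) {Γ : Ctx S} {α : Ty S.Base}
    (C : Form S (α :: Γ)) (ρ : Sub Γ []) (t : Tm S [] α) :
      lvl (C.subst (Sub.cons t ρ)) ≤ lvl ((Form.all α C).subst ρ) := by
  rw [← Form.subst_lift_inst]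
  exact (hlvl.all α (C.subst (ρ.lift α))).1 ⟨t, rfl⟩

theorem IsLevel.le_ex (hlvl : IsLevel lvl) {Γ : Ctx S} {α : Ty S.Base}
    (C : Form S (α :: Γ)) (ρ : Sub Γ []) (t : Tm S [] α) :
      lvl (C.subst (Sub.cons t ρ)) ≤ lvl ((Form.ex α C).subst ρ) := by
  rw [← Form.subst_lift_inst]
  exact (hlvl.ex α (C.subst (ρ.lift α))).1 ⟨t, rfl⟩

theorem true_congr_of_lt (hlvl : IsLevel lvl) {N N' : Interp S} {ℓ : Ordinal.{v}}
    (h : ∀ p ts, lvl (.atom p ts) < ℓ → (N p ts ↔ N' p ts)) {Γ : Ctx S} {F : Form S Γ} :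
    ∀ {ρ : Sub Γ []}, lvl (F.subst ρ) < ℓ → (F.True N N ρ ↔ F.True N' N' ρ) := by
  induction F with
  | atom p ts => exact h p _
  | bot => exact fun _ => Iff.rfl
  | top => exact fun _ => Iff.rfl
  | and A B ihA ihB =>
    intro ρ hl
    simp only [Form.subst, hlvl.and, max_lt_iff] at hl
    exact and_congr (ihA hl.1) (ihB hl.2)
  | or A B ihA ihB =>
    intro ρ hl
    simp only [Form.subst, hlvl.or, max_lt_iff] at hl
    exact or_congr (ihA hl.1) (ihB hl.2)
  | imp A B ihA ihB =>
    intro ρ hl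
    simp only [Form.subst, hlvl.imp, max_lt_iff] at hl
    exact imp_congr (ihA ((lt_add_one _).trans hl.1)) (ihB hl.2)
  | all α C ih => exact fun hl => forall_congr' fun t => ih ((hlvl.le_all C _ t).trans_lt hl)
  | ex α C ih => exact fun hl => exists_congr fun t => ih ((hlvl.le_ex C _ t).trans_lt hl)
  | nabla α C ih =>
    exact fun hl => Filter.eventually_congr
      ((hlvl.subst_lift_nom C _).mono fun k hk => ih (hk.trans_lt hl))

/-- The successor in the level of an implication puts its antecedent strictly below `ℓ`, where `N`
and `N'` agree; everywhere else truth is monotone. -/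
theorem true_mono_of_le (hlvl : IsLevel lvl) {N N' M M' : Interp S} {ℓ : Ordinal.{v}}
    (h : ∀ p ts, lvl (.atom p ts) < ℓ → (N p ts ↔ N' p ts))
    (h' : ∀ p ts, lvl (.atom p ts) ≤ ℓ → M p ts → M' p ts) {Γ : Ctx S} {F : Form S Γ} :
    ∀ {ρ : Sub Γ []}, lvl (F.subst ρ) ≤ ℓ → F.True N M ρ → F.True N' M' ρ := by
  induction F with
  | atom p ts => exact h' p _
  | bot => exact fun _ => id
  | top => exact fun _ => id
  | and A B ihA ihB =>
    intro ρ hl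
    simp only [Form.subst, hlvl.and, max_le_iff] at hl
    exact And.imp (ihA hl.1) (ihB hl.2)
  | or A B ihA ihB =>
    intro ρ hl
    simp only [Form.subst, hlvl.or, max_le_iff] at hl
    exact Or.imp (ihA hl.1) (ihB hl.2)
  | imp A B ihA ihB =>
    intro ρ hl hF hA
    simp only [Form.subst, hlvl.imp, max_le_iff] at hl
    exact ihB hl.2 (hF ((true_congr_of_lt hlvl h ((lt_add_one _).trans_le hl.1)).2 hA))
  | all α C ih => exact fun hl hC t => ih ((hlvl.le_all C _ t).trans hl) (hC t)
  | ex α C ih => exact fun hl ⟨t, hC⟩ => ⟨t, ih ((hlvl.le_ex C _ t).trans hl) hC⟩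
  | nabla α C ih =>
    intro ρ hl hC
    filter_upwards [hC, hlvl.subst_lift_nom C ρ] with k hk hk'
    exact ih (hk'.trans_le hl) hk

theorem least_mono_of_lt (hlvl : IsLevel lvl) (hDs : WeaklyStratified lvl D)
    (hIs : StrictlyStratified lvl I) {N N' : Interp S} {ℓ : Ordinal.{v}}
    (h : ∀ p ts, lvl (.atom p ts) < ℓ → (N p ts ↔ N' p ts)) {p : S.Pred}
    {ts : Sub (S.arity p) []} (hl : lvl (.atom p ts) ≤ ℓ) :
    least D I N p ts → least D I N' p ts := by
  -- Minimality is applied to an interpretation that demands nothing of atoms above `ℓ`. By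
  -- stratification, unfolding an atom of level at most `ℓ` only involves bodies of level at most
  -- `ℓ`.
  intro hN
  refine least_le (X := fun p ts => lvl (.atom p ts) ≤ ℓ → least D I N' p ts) ?_ p ts hN hl
  rintro q us (⟨h₁, c, hc, σ, h₂, h₃⟩ | ⟨B, h₁, h₂⟩) hq
  · have := hDs c hc σ
    rw [h₂] at this
    exact unfold_least N' q us (.inl ⟨h₁, c, hc, σ, h₂,
      true_mono_of_le hlvl h (fun _ _ hl hX => hX hl) (this.trans hq) h₃⟩)
  · exact unfold_least N' q us (.inr ⟨B, h₁,
      true_mono_of_le hlvl h (fun _ _ hl hX => hX hl) (((hIs q B h₁).1 us).trans hq) h₂⟩)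

theorem least_congr_of_lt (hlvl : IsLevel lvl) (hDs : WeaklyStratified lvl D)
    (hIs : StrictlyStratified lvl I) {N N' : Interp S} {p : S.Pred} {ts : Sub (S.arity p) []}
    (h : ∀ q us, lvl (.atom q us) < lvl (.atom p ts) → (N q us ↔ N' q us)) :
    least D I N p ts ↔ least D I N' p ts :=
  ⟨least_mono_of_lt hlvl hDs hIs h le_rfl,
    least_mono_of_lt hlvl hDs hIs (fun q us hl => (h q us hl).symm) le_rfl⟩

theorem exists_model (hlvl : IsLevel lvl) (hDs : WeaklyStratified lvl D)
    (hIs : StrictlyStratified lvl I) : ∃ M : Interp S, least D I M = M := by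
  -- Stage `ℓ` reads antecedents by the earlier stages, counting atoms of level at least `ℓ` as
  -- false. This default is harmless: only the values of stage `ℓ` at atoms of level `ℓ` are kept,
  -- and they depend only on lower atoms.
  let A : Ordinal.{v} → Interp S := WellFounded.fix (C := fun _ => Interp S)
    (wellFounded_lt (α := Ordinal.{v})) fun ℓ rec =>
      least D I fun p ts => ∃ h : lvl (.atom p ts) < ℓ, rec _ h p ts
  refine ⟨fun p ts => A (lvl (.atom p ts)) p ts, funext fun p => funext fun ts => propext ?_⟩
  have e : A (lvl (.atom p ts)) =
      least D I fun q us => ∃ _ : lvl (.atom q us) < lvl (.atom p ts),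
        A (lvl (.atom q us)) q us := WellFounded.fix_eq _ _ _
  rw [e]
  refine least_congr_of_lt hlvl hDs hIs fun q us hl => ?_
  simp [hl]

theorem model_unique (hlvl : IsLevel lvl) (hDs : WeaklyStratified lvl D)
    (hIs : StrictlyStratified lvl I) {M M' : Interp S} (hM : least D I M = M)
    (hM' : least D I M' = M') : M = M' := by
  have h : ∀ (ℓ : Ordinal.{v}) p ts, lvl (.atom p ts) = ℓ → (M p ts ↔ M' p ts) := by
    intro ℓ
    induction ℓ using WellFoundedLT.induction with
    | ind ℓ ih =>
      rintro p ts rfl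
      rw [← hM, ← hM']
      exact least_congr_of_lt hlvl hDs hIs fun q us hl => ih _ hl q us rfl
  exact funext fun p => funext fun ts => propext (h _ p ts rfl)

/-- The permuted model is again a fixed point of `least D I`, so uniqueness identifies it with `M`.
-/
theorem model_perm (hD : ValidDefs D) (hI : ValidInd D I) (hlvl : IsLevel lvl)
    (hDs : WeaklyStratified lvl D) (hIs : StrictlyStratified lvl I) {M : Interp S}
    (hM : least D I M = M) (π : NomPerm S) : M.perm π = M :=
  model_unique hlvl hDs hIs (by rw [least_perm hD hI, hM]) hM

theorem model_iff_unfold {M : Interp S} (hM : least D I M = M) {p : S.Pred}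
    {ts : Sub (S.arity p) []} : M p ts ↔ unfold D I M M p ts := by
  have h₁ := unfold_least (D := D) (I := I) M p ts
  have h₂ := least_le_unfold (D := D) (I := I) M p ts
  rw [hM] at h₁ h₂
  exact ⟨h₂, h₁⟩

-- This is the soundness of induction: `M p` lies in every set closed under the body of `p`, the
-- other predicates being read by `M`.
open Classical in
theorem model_induction (hlvl : IsLevel lvl) (hIs : StrictlyStratified lvl I) {M : Interp S}
    (hM : least D I M = M) {p : S.Pred} {B : Form S (S.arity p)} (hB : I p = some B)
    {X : Sub (S.arity p) [] → Prop}
    (h : ∀ ts, B.True (Function.update M p X) (Function.update M p X) ts → X ts)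
    {ts : Sub (S.arity p) []} (hts : M p ts) : X ts := by
  -- Intersecting with `M` makes closure under unfolding automatic except for membership in `X` at
  -- the predicate `p`.
  let Y : Interp S := fun q us => M q us ∧ Function.update M p X q us
  have hY : unfold D I M Y ≤ Y := by
    intro q us hq
    have hq' : M q us := (model_iff_unfold hM).2 (unfold_mono (fun _ _ h => h.1) q us hq)
    refine ⟨hq', ?_⟩
    by_cases e : q = p
    · subst e
      rw [Function.update_self]
      rcases hq with ⟨h₁, _⟩ | ⟨B', h₁, h₂⟩
      · simp [hB] at h₁
      · obtain rfl : B = B' := Option.some.inj (hB.symm.trans h₁)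
        refine h us (true_mono_of_le hlvl (fun r vs hl => ?_) (fun _ _ _ h => h.2)
          ((hIs q B hB).1 us) h₂)
        -- Atoms of `p` share one level, so an atom strictly below it has another predicate, where
        -- the updated interpretation agrees with `M`. Thus antecedents may be read by either.
        have : r ≠ q := by
          rintro rfl
          exact hl.ne ((hIs r B hB).2 _ _)
        rw [Function.update_of_ne this]
    · rwa [Function.update_of_ne e]
  have := least_le hY p ts (by rwa [hM])
  simpa using this.2

end Model

-- Validity of sequents and soundness of the rules.

noncomputable section Soundness

variable {S : Signature.{u}}

/-- Sequents that are true under all grounding substitutions whose support is disjoint from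
the supports of the formulas in the sequent. -/
def Valid (M : Interp S) (X : Ctx S) (Γ : Multiset (Form S X)) (C : Form S X) : Prop :=
  ∀ ρ : Sub X [], Disjoint ρ.supp {n | ∃ G ∈ C ::ₘ Γ, n ∈ G.supp} →
    (∀ G ∈ Γ, G.True M M ρ) → C.True M M ρ

theorem finite_iUnion_supp {X : Ctx S} (Γ : Multiset (Form S X)) :
    {n | ∃ G ∈ Γ, n ∈ G.supp}.Finite := by
  have : {n | ∃ G ∈ Γ, n ∈ G.supp} = ⋃ G ∈ {G | G ∈ Γ}, G.supp := by
    ext n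
    simp
  rw [this]
  exact (Multiset.finite_toSet Γ).biUnion fun G _ => G.finite_supp

theorem Form.true_perm_iff {M : Interp S} (hM : ∀ π, M.perm π = M) (π : NomPerm S) {X : Ctx S}
    {F : Form S X} {ρ : Sub X []} :
    (F.perm π).True M M (fun τ x => (ρ τ x).perm π) ↔ F.True M M ρ := by
  rw [← Form.true_perm, hM]

theorem Sub.mem_supp_perm {π : NomPerm S} {Γ Δ : Ctx S} {σ : Sub Γ Δ} {n : Nominal S}
    (h : n ∈ Sub.supp fun τ x => (σ τ x).perm π) : ∃ m ∈ σ.supp, n = (m.1, π m.1 m.2) := by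
  obtain ⟨τ, x, h⟩ := h
  obtain ⟨m, hm, h⟩ := Tm.mem_supp_perm h
  exact ⟨m, ⟨τ, x, hm⟩, h⟩

/-- For validity, one may discard the grounding substitutions that meet a given finite set. -/
theorem Valid.of_disjoint {M : Interp S} (hM : ∀ π, M.perm π = M) {X : Ctx S}
    {Γ : Multiset (Form S X)} {C : Form S X} {A : Set (Nominal S)} (hA : A.Finite)
    (h : ∀ ρ : Sub X [], Disjoint ρ.supp A → (∀ G ∈ Γ, G.True M M ρ) → C.True M M ρ) :
    Valid M X Γ C := by
  intro ρ hρ hΓ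
  -- Since `ρ` avoids the constants of the sequent, some `π` fixes these and moves those of `ρ` away
  -- from `A`. The formulas and `M` are invariant under `π`, so truth under `ρ` and under its
  -- permuted version coincide.
  obtain ⟨π, h₁, h₂⟩ := exists_nomPerm (finite_iUnion_supp (C ::ₘ Γ)) (Sub.finite_supp ρ) hA hρ
  have hG : ∀ G ∈ C ::ₘ Γ, G.perm π = G := fun G hG =>
    Form.perm_eq_self fun τ k hk => h₁ τ k ⟨G, hG, hk⟩
  rw [← Form.true_perm_iff hM π, hG C (Multiset.mem_cons_self _ _)]
  refine h _ (Set.disjoint_left.2 fun n hn hnA => ?_) fun G hG' => ?_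
  · obtain ⟨m, hm, rfl⟩ := Sub.mem_supp_perm hn
    exact h₂ _ _ hm hnA
  · rw [← hG G (Multiset.mem_cons_of_mem hG'), Form.true_perm_iff hM]
    exact hΓ G hG'

theorem Tm.mem_supp_app {Γ : Ctx S} {α β : Ty S.Base} {t : Tm S Γ (.arr α β)} {s : Tm S Γ α}
    {n : Nominal S} (h : n ∈ (t.app s).supp) : n ∈ t.supp ∨ n ∈ s.supp := by
  by_contra! hc
  obtain ⟨r, rfl, hr⟩ := Tm.notMem_supp.1 hc.1
  obtain ⟨q, rfl, hq⟩ := Tm.notMem_supp.1 hc.2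
  exact (h (.app r q) rfl).elim hr hq

theorem Tm.mem_supp_appNoms {Γ : Ctx S} {τ : Ty S.Base} {n : Nominal S} (ns : List (Nominal S)) :
    ∀ {t : Tm S Γ (raiseTy ns τ)}, n ∈ (Tm.appNoms ns t).supp → n ∈ t.supp ∨ n ∈ ns := by
  induction ns with
  | nil => exact fun h => .inl h
  | cons m ns ih =>
    intro t h
    rcases ih h with h | h
    · rcases Tm.mem_supp_app h with h | h
      · exact .inl h
      · exact .inr (by simp [Tm.mem_supp_nom h])
    · exact .inr (List.mem_cons_of_mem _ h)

theorem Sub.raise_comp_cons {Γ Δ : Ctx S} (ns : List (Nominal S)) (α : Ty S.Base)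
    (s : Tm S Δ (raiseTy ns α)) (ρ : Sub Γ Δ) :
    (fun τ x => (Sub.raise ns α τ x).subst (Sub.cons s ρ)) = Sub.cons (Tm.appNoms ns s) ρ := by
  rw [Sub.raise, Sub.cons_comp, Tm.appNoms_subst, Tm.subst_var]
  congr 1
  funext τ x
  exact Tm.subst_var _ _

theorem Sub.wk_comp_cons {Γ Δ : Ctx S} {α : Ty S.Base} (s : Tm S Δ α) (ρ : Sub Γ Δ) :
    (fun τ x => (Sub.wk Γ α τ x).subst (Sub.cons s ρ)) = ρ := by
  funext τ x
  exact Tm.subst_var _ _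

theorem Sub.mem_supp_raise {Γ : Ctx S} {ns : List (Nominal S)} {α : Ty S.Base} {n : Nominal S}
    (h : n ∈ (Sub.raise (Γ := Γ) ns α).supp) : n ∈ ns := by
  rcases Sub.mem_supp_cons h with h | h
  · rcases Tm.mem_supp_appNoms ns h with h | h
    · simp [Tm.supp_var] at h
    · exact h
  · simp [Sub.supp_wk] at h

theorem Form.mem_supp_subst_wk {Γ : Ctx S} {α : Ty S.Base} {F : Form S Γ} {n : Nominal S}
    (h : n ∈ (F.subst (Sub.wk Γ α)).supp) : n ∈ F.supp :=
  (Form.mem_supp_subst h).resolve_right (by simp [Sub.supp_wk])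

theorem Form.mem_supp_subst_raise {Γ : Ctx S} {ns : List (Nominal S)} {α : Ty S.Base}
    {C : Form S (α :: Γ)} (hns : ∀ n, n ∈ ns ↔ n ∈ C.supp) {n : Nominal S}
    (h : n ∈ (C.subst (Sub.raise ns α)).supp) : n ∈ C.supp :=
  (Form.mem_supp_subst h).elim id fun h => (hns n).1 (Sub.mem_supp_raise h)

/-- Instances of a formula amount to instances of its raised form that avoid given nominals. -/
theorem exists_true_raise_iff {M : Interp S} (hM : ∀ π, M.perm π = M) {X : Ctx S} {α : Ty S.Base}
    {C : Form S (α :: X)} {ns : List (Nominal S)} (hns : ∀ n, n ∈ ns ↔ n ∈ C.supp)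
    {ρ : Sub X []} {A : Set (Nominal S)} (hA : A.Finite)
    (hρ : Disjoint ρ.supp A) (t : Tm S [] α) :
    ∃ s : Tm S [] (raiseTy ns α), Disjoint (Sub.cons s ρ).supp A ∧
      ((C.subst (Sub.raise ns α)).True M M (Sub.cons s ρ) ↔ C.True M M (Sub.cons t ρ)) := by
  -- The constants of `t` are of three kinds: those of `C` are abstracted by the raising, those of
  -- `ρ` avoid `A` already, and the remaining ones are moved away from `A` by `π`.
  obtain ⟨π, h₁, h₂⟩ := exists_nomPerm (F := C.supp ∪ ρ.supp) (R := t.supp \ (C.supp ∪ ρ.supp))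
    (C.finite_supp.union ρ.finite_supp) t.finite_supp.sdiff hA Set.disjoint_sdiff_left
  obtain ⟨s, hs, h⟩ := Tm.exists_absNoms (t.perm π) ns
  refine ⟨s, Set.disjoint_left.2 fun n hn hnA => ?_, ?_⟩
  · have hnρ : n ∉ ρ.supp := fun h => Set.disjoint_left.1 hρ h hnA
    rcases Sub.mem_supp_cons hn with hn | hn
    · obtain ⟨h₃, h₄⟩ := h n hn
      rw [hns] at h₄
      obtain ⟨m, hm, rfl⟩ := Tm.mem_supp_perm h₃
      by_cases hm' : m ∈ C.supp ∪ ρ.supp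
      · rw [h₁ _ _ hm'] at h₄ hnρ
        exact hm'.elim h₄ hnρ
      · exact h₂ _ _ ⟨hm, hm'⟩ hnA
    · exact hnρ hn
  · have hρπ : (fun τ x => (ρ τ x).perm π) = ρ := by
      funext τ x
      exact Tm.perm_eq_self fun τ' k hk => h₁ τ' k (.inr ⟨τ, x, hk⟩)
    rw [Form.true_subst, Sub.raise_comp_cons, hs, ← Form.true_perm_iff hM π (ρ := Sub.cons t ρ),
      Sub.perm_cons, hρπ, Form.perm_eq_self fun τ k hk => h₁ τ k (.inl hk)]

/-- Swapping two constants fresh for `C` and `ρ` changes neither, so by invariance all fresh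
constants give the same truth value, and all but finitely many constants are fresh. -/
theorem Form.true_nabla_iff {M : Interp S} (hM : ∀ π, M.perm π = M) {X : Ctx S} {α : Ty S.Base}
    {C : Form S (α :: X)} {ρ : Sub X []} {k : ℕ} (hk : (α, k) ∉ C.supp) (hk' : (α, k) ∉ ρ.supp) :
    (Form.nabla α C).True M M ρ ↔ C.True M M (Sub.cons (Tm.nom (α, k)) ρ) := by
  classical
  have key : ∀ j, (α, j) ∉ C.supp ∪ ρ.supp → (C.True M M (Sub.cons (Tm.nom (α, j)) ρ) ↔
      C.True M M (Sub.cons (Tm.nom (α, k)) ρ)) := by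
    intro j hj
    let π : NomPerm S := Function.update (fun _ => Equiv.refl ℕ) α (Equiv.swap j k)
    have hπ : ∀ τ i, (τ, i) ∈ C.supp ∪ ρ.supp → π τ i = i := by
      intro τ i hi
      by_cases h : τ = α
      · subst h
        have h₁ : i ≠ j := fun h => hj (h ▸ hi)
        have h₂ : i ≠ k := fun h => (h ▸ hi : (τ, k) ∈ C.supp ∪ ρ.supp).elim hk hk'
        simp [π, Equiv.swap_apply_of_ne_of_ne h₁ h₂]
      · simp [π, Function.update_of_ne h]
    have hρπ : (fun τ x => (ρ τ x).perm π) = ρ := by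
      funext τ x
      exact Tm.perm_eq_self fun τ' k hk => hπ τ' k (.inr ⟨τ, x, hk⟩)
    rw [← Form.true_perm_iff hM π, Sub.perm_cons, hρπ,
      Form.perm_eq_self fun τ k hk => hπ τ k (.inl hk), Tm.perm_nom]
    have hj : π α j = k := by simp [π]
    rw [hj]
  have hf : {j | (α, j) ∈ C.supp ∪ ρ.supp}.Finite :=
    (C.finite_supp.union ρ.finite_supp).preimage (Prod.mk_right_injective α).injOn
  constructor
  · intro h
    obtain ⟨j, hj, hj'⟩ := (Filter.Eventually.and h hf.compl_mem_cofinite).exists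
    exact (key j hj').1 hj
  · intro h
    exact Filter.mem_of_superset hf.compl_mem_cofinite fun j hj => (key j hj).2 h

theorem Form.true_subst_inst {M : Interp S} {X : Ctx S} {α : Ty S.Base} {C : Form S (α :: X)}
    {t : Tm S X α} {ρ : Sub X []} :
    (C.subst (Sub.inst t)).True M M ρ ↔ C.True M M (Sub.cons (t.subst ρ) ρ) := by
  rw [Form.true_subst, Sub.inst, Sub.cons_comp]
  simp only [Sub.id, Tm.subst_var]

open Classical in
theorem Form.true_replacePred {M : Interp S} {Γ : Ctx S} {F : Form S Γ} {p : S.Pred}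
    {J : Form S (S.arity p)} {ρ : Sub Γ []} : (F.replacePred p J).True M M ρ ↔
      F.True (Function.update M p fun us => J.True M M us)
        (Function.update M p fun us => J.True M M us) ρ := by
  rw [Form.replacePred, Form.true_predSubst]
  have : (fun q us => (Function.update (fun q => Form.atom q (Sub.id (S.arity q))) p J q).True M M
      us) = Function.update M p fun us => J.True M M us := by
    funext q us
    by_cases h : q = p
    · subst h
      simp
    · simp [Function.update_of_ne h, Form.True, Sub.id]
  rw [this]

/-- A ground instance of an atom that matches the head of a clause comes from a substitution with
empty support under which the atom already matches the head. -/
theorem exists_defn_of_subst_eq {c : Clause S} (hH : c.head.supp = ∅) (hB : c.body.supp = ∅)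
    {X : Ctx S} {A : Form S X} {p : S.Pred} {ts : Sub (S.arity p) X} (hA : A = .atom p ts)
    {ρ : Sub X []} (hρ : Disjoint ρ.supp A.supp) {σ : Sub c.ctx []}
    (h : c.head.subst σ = A.subst ρ) :
    ∃ (Z : Ctx S) (θ : Sub X Z) (B : Form S Z) (b : Sub Z []), θ.IsRange ∧ Defn c A θ B ∧
      b.supp ⊆ ρ.supp ∧ Disjoint b.supp B.supp ∧ (fun τ x => (θ τ x).subst b) = ρ ∧
      B.subst b = c.body.subst σ := by
  subst hA
  obtain ⟨l, hl, hlρ⟩ : ∃ l : List (Nominal S), l.Nodup ∧ ∀ n, n ∈ l ↔ n ∈ ρ.supp :=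
    ⟨ρ.finite_supp.toFinset.toList, Finset.nodup_toList _, by simp⟩
  obtain ⟨Z, R, b, h₁, h₂, h₃, h₄, h₅⟩ := exists_nominals_as_variables l hl
  -- `E` turns the constants of `ρ` into the variables of `Z`, and `b` turns them back; the unifier
  -- `θ` is `ρ` followed by `E`.
  let E : Env [] Z := fun τ => Sum.elim (fun x => nomatch x) (R τ)
  have hEb : ∀ {τ} (t : Tm S [] τ), (t.bind E).subst b = t := by
    intro τ t
    rw [Tm.subst_eq_bind, Tm.bind_bind]
    conv_rhs => rw [← t.bind_id]
    refine t.bind_congr (fun _ x => nomatch x) fun τ' k _ => ?_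
    rw [← Tm.subst_eq_bind]
    exact h₁ τ' k
  have hE : ∀ {τ} {t : Tm S [] τ} {n}, n ∈ (t.bind E).supp → n ∈ t.supp ∧ n ∉ l := by
    intro τ t n hn
    rcases Tm.mem_supp_bind hn with ⟨_, x, _⟩ | ⟨τ', k, hk, hn⟩
    · nomatch x
    · by_cases hkl : (τ', k) ∈ l
      · simp [E, h₂ τ' k hkl] at hn
      · simp only [E, Sum.elim_inr, h₃ τ' k hkl] at hn
        obtain rfl := Tm.mem_supp_nom hn
        exact ⟨hk, hkl⟩
  have hcongr : ∀ {Y : Ctx S} {τ} (t : Tm S Y τ) (ν : Sub Y []), (∀ n ∈ t.supp, n ∉ l) →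
      (t.subst ν).bind E = t.subst (fun τ x => (ν τ x).bind E) := by
    intro Y τ t ν ht
    rw [Tm.subst_bind, Tm.subst_eq_bind]
    exact t.bind_congr (fun _ _ => rfl) fun τ' k hk => h₃ τ' k (ht _ hk)
  have hθ : (Sub.supp fun τ x => (ρ τ x).bind E) = ∅ := by
    refine Set.eq_empty_of_forall_notMem ?_
    rintro n ⟨τ, x, hn⟩
    obtain ⟨h₆, h₇⟩ := hE hn
    exact h₇ ((hlρ n).2 ⟨τ, x, h₆⟩)
  have hθb : (fun τ x => ((ρ τ x).bind E).subst b) = ρ := by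
    funext τ x
    exact hEb _
  refine ⟨Z, fun τ x => (ρ τ x).bind E, c.body.subst fun τ x => (σ τ x).bind E, b, ?_,
    ⟨hθ, _, ?_, rfl⟩, fun n hn => (hlρ n).1 (h₄ n hn), ?_, hθb, ?_⟩
  · intro ζ z
    -- If `z` did not occur in `θ`, then `b` could be replaced by `b'` without changing the
    -- composite `ρ`; but `ρ` contains `n`, which occurs neither in `θ` nor in `b'`.
    by_contra! hz
    obtain ⟨b', hb, n, hn, hn'⟩ := h₅ ζ z
    obtain ⟨τ, x, hx⟩ := (hlρ n).1 hn
    rw [← hEb (ρ τ x), Tm.subst_congr_of_not_occurs _ (hz τ x) hb] at hx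
    rcases Tm.mem_supp_subst hx with hx | hx
    · exact (Set.ext_iff.1 hθ n).1 ⟨τ, x, hx⟩
    · exact hn' hx
  · obtain ⟨Y, q, as, body⟩ := c
    simp only [Clause.head, Form.subst, Form.atom.injEq] at h ⊢
    obtain ⟨rfl, h⟩ := h
    refine ⟨rfl, heq_of_eq ?_⟩
    have h := eq_of_heq h
    funext τ x
    -- `E` is applied to both sides of the matching equation. It passes through the head, which has
    -- no nominal constants, and through `A`, which has none of those in `ρ`, and so acts only on
    -- `σ` and `ρ`.
    have h' := congrArg (fun t => t.bind E) (congrFun (congrFun h τ) x)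
    rwa [hcongr, hcongr] at h'
    · intro n hn hnl
      exact Set.disjoint_left.1 hρ ((hlρ n).1 hnl) ⟨τ, x, hn⟩
    · intro n hn
      exact ((Set.ext_iff.1 hH n).1 ⟨τ, x, hn⟩).elim
  · refine Set.disjoint_left.2 fun n hn hn' => ?_
    rcases Form.mem_supp_subst hn' with hn' | ⟨τ, x, hn'⟩
    · simp [hB] at hn'
    · exact (hE hn').2 (h₄ n hn)
  · rw [Form.subst_subst]
    simp only [hEb]

/-- A true ground instance of the atom comes from a clause, and its grounding substitution factors
as `θ` followed by `b`; the premise for `θ` is then used under `b`. -/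
theorem Valid.defL {M : Interp S} {D : Set (Clause S)} (hD : ValidDefs D)
    {X : Ctx S} {Γ : Multiset (Form S X)} {C : Form S X} {p : S.Pred} {ts : Sub (S.arity p) X}
    (hp : ∀ us, M p us → ∃ c ∈ D, ∃ σ : Sub c.ctx [],
      c.head.subst σ = .atom p us ∧ c.body.True M M σ)
    (h : ∀ c ∈ D, ∀ (Z : Ctx S) (θ : Sub X Z) (B : Form S Z), θ.IsRange →
      Defn c (Form.atom p ts) θ B → Valid M Z (B ::ₘ Γ.map fun G => G.subst θ) (C.subst θ)) :
    Valid M X (Form.atom p ts ::ₘ Γ) C := by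
  intro ρ hρ hΓ
  rw [Multiset.forall_mem_cons] at hΓ
  obtain ⟨c, hc, σ, h₁, h₂⟩ := hp _ hΓ.1
  have hd : ∀ {G n}, G ∈ C ::ₘ Form.atom p ts ::ₘ Γ → n ∈ ρ.supp → n ∉ G.supp :=
    fun hG hn hn' => Set.disjoint_left.1 hρ hn ⟨_, hG, hn'⟩
  obtain ⟨Z, θ, B, b, hθ, hdef, hb, hbB, rfl, hB⟩ :=
    exists_defn_of_subst_eq (hD c hc).1 (hD c hc).2.1 (A := .atom p ts) rfl
      (Set.disjoint_left.2 fun n hn => hd (by simp) hn) h₁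
  have h₃ := h c hc Z θ B hθ hdef b ?_ ?_
  · rwa [Form.true_subst] at h₃
  · have hs : ∀ {G : Form S X} {n}, G ∈ C ::ₘ Form.atom p ts ::ₘ Γ → n ∈ b.supp →
        n ∉ (G.subst θ).supp := by
      intro G n hG hn hn'
      rcases Form.mem_supp_subst hn' with hn' | hn'
      · exact hd hG (hb hn) hn'
      · simp [hdef.1] at hn'
    refine Set.disjoint_left.2 ?_
    rintro n hn ⟨G, hG, hn'⟩
    simp only [Multiset.mem_cons, Multiset.mem_map] at hG
    rcases hG with rfl | rfl | ⟨G, hG, rfl⟩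
    · exact hs (by simp) hn hn'
    · exact Set.disjoint_left.1 hbB hn hn'
    · exact hs (by simp [hG]) hn hn'
  · simp only [Multiset.mem_cons, Multiset.mem_map]
    rintro _ (rfl | ⟨G, hG, rfl⟩)
    -- The body instance is ground, so its truth is moved along `hB` by evaluating at the identity
    -- on the empty context.
    · have h₄ : (c.body.subst σ).True M M (Sub.id []) := by
        rw [Form.true_subst]
        simpa only [Tm.subst_id] using h₂
      rw [← hB, Form.true_subst] at h₄
      simpa only [Tm.subst_id] using h₄
    · rw [Form.true_subst]
      exact hΓ.2 G hG

theorem Valid.defR {M : Interp S} (hM : ∀ π, M.perm π = M) {c : Clause S}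
    {X : Ctx S} {Γ : Multiset (Form S X)} {p : S.Pred} {ts : Sub (S.arity p) X} {B : Form S X}
    (hp : ∀ us, ∀ σ : Sub c.ctx [], c.head.subst σ = .atom p us → c.body.True M M σ → M p us)
    (hB : Defn c (Form.atom p ts) (Sub.id X) B) (h : Valid M X Γ B) :
    Valid M X Γ (Form.atom p ts) := by
  refine Valid.of_disjoint hM (finite_iUnion_supp (B ::ₘ Γ)) fun ρ hρ hΓ => ?_
  obtain ⟨_, σ, h₁, rfl⟩ := hB
  have h₂ := h ρ hρ hΓ
  rw [Form.true_subst] at h₂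
  refine hp _ _ ?_ h₂
  rw [← Form.subst_subst, h₁, Form.subst_subst]
  simp [Sub.id, Form.subst]

theorem subset_sum_of_mem {α : Type*} {l : List (Multiset α)} {s : Multiset α} (h : s ∈ l)
    {a : α} (ha : a ∈ s) : a ∈ l.sum := by
  induction l with
  | nil => simp at h
  | cons t l ih =>
    rw [List.sum_cons, Multiset.mem_add]
    rcases List.mem_cons.1 h with rfl | h
    · exact .inl ha
    · exact .inr (ih h)

/-- Cut formulas may contain nominal constants absent from the conclusion, so only grounding
substitutions that avoid these too are considered. -/
theorem Valid.mc {M : Interp S} (hM : ∀ π, M.perm π = M) {X : Ctx S} {Γ : Multiset (Form S X)}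
    {C : Form S X} (cuts : List (Multiset (Form S X) × Form S X))
    (h : ∀ c ∈ cuts, Valid M X c.1 c.2)
    (h' : Valid M X (Γ + (cuts.map Prod.snd : List (Form S X))) C) :
    Valid M X (Γ + (cuts.map Prod.fst).sum) C := by
  have hf : (⋃ c ∈ {c | c ∈ cuts}, {n | ∃ G ∈ c.2 ::ₘ c.1, n ∈ G.supp}).Finite :=
    cuts.finite_toSet.biUnion fun c _ => finite_iUnion_supp _
  refine Valid.of_disjoint hM (hf.union (finite_iUnion_supp
    (C ::ₘ (Γ + (cuts.map Prod.snd : List (Form S X)))))) fun ρ hρ hΓ => ?_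
  rw [Set.disjoint_union_right] at hρ
  refine h' ρ hρ.2 fun G hG => ?_
  rcases Multiset.mem_add.1 hG with hG | hG
  · exact hΓ G (Multiset.mem_add.2 (.inl hG))
  · obtain ⟨c, hc, rfl⟩ := List.mem_map.1 (Multiset.mem_coe.1 hG)
    refine h c hc ρ (hρ.1.mono_right fun n hn => Set.mem_iUnion₂.2 ⟨c, hc, hn⟩)
      fun G hG => hΓ G (Multiset.mem_add.2 (.inr ?_))
    exact subset_sum_of_mem (List.mem_map_of_mem hc) hG

/-- `π` moves only constants of `A`, which `ρ` avoids, so `π` fixes `ρ` and invariance of the model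
applies. -/
theorem Valid.ax {M : Interp S} (hM : ∀ π, M.perm π = M) {X : Ctx S} (A : Form S X)
    (π : NomPerm S) (hπ : ∀ τ k, (τ, k) ∉ A.supp → π τ k = k) : Valid M X {A} (A.perm π) := by
  intro ρ hρ hA
  have hρπ : (fun τ x => (ρ τ x).perm π) = ρ := by
    funext τ x
    exact Tm.perm_eq_self fun τ' k hk =>
      hπ τ' k fun hk' => Set.disjoint_left.1 hρ ⟨τ, x, hk⟩ ⟨A, by simp, hk'⟩
  rw [← hρπ, Form.true_perm_iff hM]
  exact hA A (by simp)

theorem Valid.allR {M : Interp S} (hM : ∀ π, M.perm π = M) {X : Ctx S} {Γ : Multiset (Form S X)}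
    {α : Ty S.Base} {C : Form S (α :: X)} {ns : List (Nominal S)}
    (hns : ∀ n, n ∈ ns ↔ n ∈ C.supp)
    (h : Valid M (raiseTy ns α :: X) (Γ.map fun G => G.subst (Sub.wk X (raiseTy ns α)))
      (C.subst (Sub.raise ns α))) : Valid M X Γ (.all α C) := by
  intro ρ hρ hΓ t
  obtain ⟨s, hs, hst⟩ := exists_true_raise_iff hM hns
    (finite_iUnion_supp (Form.all α C ::ₘ Γ)) hρ t
  refine hst.1 (h _ (hs.mono_right ?_) fun G hG => ?_)
  · rintro n ⟨G, hG, hn⟩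
    rcases Multiset.mem_cons.1 hG with rfl | hG
    · exact ⟨.all α C, by simp, Form.mem_supp_subst_raise hns hn⟩
    · obtain ⟨G, hG', rfl⟩ := Multiset.mem_map.1 hG
      exact ⟨G, by simp [hG'], Form.mem_supp_subst_wk hn⟩
  · obtain ⟨G, hG', rfl⟩ := Multiset.mem_map.1 hG
    rw [Form.true_subst, Sub.wk_comp_cons]
    exact hΓ G hG'

theorem Valid.exL {M : Interp S} (hM : ∀ π, M.perm π = M) {X : Ctx S} {Γ : Multiset (Form S X)}
    {α : Ty S.Base} {C : Form S (α :: X)} {E : Form S X} {ns : List (Nominal S)}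
    (hns : ∀ n, n ∈ ns ↔ n ∈ C.supp)
    (h : Valid M (raiseTy ns α :: X)
      (C.subst (Sub.raise ns α) ::ₘ Γ.map fun G => G.subst (Sub.wk X (raiseTy ns α)))
      (E.subst (Sub.wk X (raiseTy ns α)))) : Valid M X (.ex α C ::ₘ Γ) E := by
  intro ρ hρ hΓ
  rw [Multiset.forall_mem_cons] at hΓ
  obtain ⟨t, ht⟩ := hΓ.1
  obtain ⟨s, hs, hst⟩ := exists_true_raise_iff hM hns
    (finite_iUnion_supp (E ::ₘ Form.ex α C ::ₘ Γ)) hρ t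
  have h' := h (Sub.cons s ρ) (hs.mono_right ?_) ?_
  · rwa [Form.true_subst, Sub.wk_comp_cons] at h'
  · rintro n ⟨G, hG, hn⟩
    simp only [Multiset.mem_cons, Multiset.mem_map] at hG
    rcases hG with rfl | rfl | ⟨G, hG, rfl⟩
    · exact ⟨E, by simp, Form.mem_supp_subst_wk hn⟩
    · exact ⟨.ex α C, by simp, Form.mem_supp_subst_raise hns hn⟩
    · exact ⟨G, by simp [hG], Form.mem_supp_subst_wk hn⟩
  · simp only [Multiset.mem_cons, Multiset.mem_map]
    rintro _ (rfl | ⟨G, hG, rfl⟩)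
    · exact hst.2 ht
    · rw [Form.true_subst, Sub.wk_comp_cons]
      exact hΓ.2 G hG

theorem Valid.nablaL {M : Interp S} (hM : ∀ π, M.perm π = M) {X : Ctx S}
    {Γ : Multiset (Form S X)} {α : Ty S.Base} {C : Form S (α :: X)} {E : Form S X} {k : ℕ}
    (hk : (α, k) ∉ C.supp)
    (h : Valid M X (C.subst (Sub.inst (Tm.nom (α, k))) ::ₘ Γ) E) :
    Valid M X (.nabla α C ::ₘ Γ) E := by
  -- Avoiding `(α, k)` as well makes it fresh for `ρ`, so it may stand for all fresh constants.
  refine Valid.of_disjoint hM ((finite_iUnion_supp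
    (E ::ₘ C.subst (Sub.inst (Tm.nom (α, k))) ::ₘ Γ)).insert (α, k)) fun ρ hρ hΓ => ?_
  rw [Set.disjoint_insert_right] at hρ
  rw [Multiset.forall_mem_cons] at hΓ
  refine h ρ hρ.2 (Multiset.forall_mem_cons.2 ⟨?_, hΓ.2⟩)
  rw [Form.true_subst_inst, Tm.subst_nom]
  exact (Form.true_nabla_iff hM hk hρ.1).1 hΓ.1

theorem Valid.nablaR {M : Interp S} (hM : ∀ π, M.perm π = M) {X : Ctx S}
    {Γ : Multiset (Form S X)} {α : Ty S.Base} {C : Form S (α :: X)} {k : ℕ}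
    (hk : (α, k) ∉ C.supp) (h : Valid M X Γ (C.subst (Sub.inst (Tm.nom (α, k))))) :
    Valid M X Γ (.nabla α C) := by
  refine Valid.of_disjoint hM ((finite_iUnion_supp
    (C.subst (Sub.inst (Tm.nom (α, k))) ::ₘ Γ)).insert (α, k)) fun ρ hρ hΓ => ?_
  rw [Set.disjoint_insert_right] at hρ
  have h' := h ρ hρ.2 hΓ
  rw [Form.true_subst_inst, Tm.subst_nom] at h'
  exact (Form.true_nabla_iff hM hk hρ.1).2 h'

theorem Valid.indL {M : Interp S} (hM : ∀ π, M.perm π = M) {X : Ctx S}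
    {Γ : Multiset (Form S X)} {C : Form S X} {p : S.Pred} {J : Form S (S.arity p)}
    {ts : Sub (S.arity p) X} (hp : ∀ us, M p us → J.True M M us)
    (h : Valid M X (J.subst ts ::ₘ Γ) C) : Valid M X (.atom p ts ::ₘ Γ) C := by
  refine Valid.of_disjoint hM (finite_iUnion_supp (C ::ₘ J.subst ts ::ₘ Γ)) fun ρ hρ hΓ => ?_
  rw [Multiset.forall_mem_cons] at hΓ
  refine h ρ hρ (Multiset.forall_mem_cons.2 ⟨?_, hΓ.2⟩)
  rw [Form.true_subst]
  exact hp _ hΓ.1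

/-- Rules with one premise over the same context, which are truth-preserving. -/
theorem Valid.of_imp {M : Interp S} (hM : ∀ π, M.perm π = M) {X : Ctx S}
    {Γ Γ' : Multiset (Form S X)} {C C' : Form S X} (h : Valid M X Γ C)
    (hi : ∀ ρ, ((∀ G ∈ Γ, G.True M M ρ) → C.True M M ρ) →
      (∀ G ∈ Γ', G.True M M ρ) → C'.True M M ρ) : Valid M X Γ' C' :=
  Valid.of_disjoint hM (finite_iUnion_supp (C ::ₘ Γ)) fun ρ hρ => hi ρ (h ρ hρ)

theorem Valid.of_imp₂ {M : Interp S} (hM : ∀ π, M.perm π = M) {X : Ctx S}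
    {Γ₁ Γ₂ Γ' : Multiset (Form S X)} {C₁ C₂ C' : Form S X} (h₁ : Valid M X Γ₁ C₁)
    (h₂ : Valid M X Γ₂ C₂)
    (hi : ∀ ρ, ((∀ G ∈ Γ₁, G.True M M ρ) → C₁.True M M ρ) →
      ((∀ G ∈ Γ₂, G.True M M ρ) → C₂.True M M ρ) →
      (∀ G ∈ Γ', G.True M M ρ) → C'.True M M ρ) : Valid M X Γ' C' :=
  Valid.of_disjoint hM ((finite_iUnion_supp (C₁ ::ₘ Γ₁)).union (finite_iUnion_supp (C₂ ::ₘ Γ₂)))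
    fun ρ hρ => hi ρ (h₁ ρ (hρ.mono_right Set.subset_union_left))
      (h₂ ρ (hρ.mono_right Set.subset_union_right))

variable {D : Set (Clause S)} {I : IndDefs S} {lvl : Form S [] → Ordinal.{v}}

theorem Derivable.valid (hD : ValidDefs D) (hI : ValidInd D I) (hlvl : IsLevel lvl)
    (hIs : StrictlyStratified lvl I) {M : Interp S} (hM : ∀ π, M.perm π = M)
    (hM' : least D I M = M) {X : Ctx S} {Γ : Multiset (Form S X)} {C : Form S X}
    (h : Derivable D I X Γ C) : Valid M X Γ C := by
  classical
  induction h with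
  | botL Γ B => exact fun ρ _ hΓ => (hΓ .bot (by simp)).elim
  | topR Γ => exact fun ρ _ _ => trivial
  | impL _ _ ih₁ ih₂ =>
    refine Valid.of_imp₂ hM ih₁ ih₂ fun ρ h₁ h₂ hΓ => ?_
    rw [Multiset.forall_mem_cons] at hΓ h₂
    exact h₂ ⟨hΓ.1 (h₁ hΓ.2), hΓ.2⟩
  | impR _ ih =>
    refine Valid.of_imp hM ih fun ρ h hΓ hB => ?_
    rw [Multiset.forall_mem_cons] at h
    exact h ⟨hB, hΓ⟩
  | andL₁ _ ih =>
    refine Valid.of_imp hM ih fun ρ h hΓ => ?_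
    rw [Multiset.forall_mem_cons] at h hΓ
    exact h ⟨hΓ.1.1, hΓ.2⟩
  | andL₂ _ ih =>
    refine Valid.of_imp hM ih fun ρ h hΓ => ?_
    rw [Multiset.forall_mem_cons] at h hΓ
    exact h ⟨hΓ.1.2, hΓ.2⟩
  | andR _ _ ih₁ ih₂ => exact Valid.of_imp₂ hM ih₁ ih₂ fun ρ h₁ h₂ hΓ => ⟨h₁ hΓ, h₂ hΓ⟩
  | orL _ _ ih₁ ih₂ =>
    refine Valid.of_imp₂ hM ih₁ ih₂ fun ρ h₁ h₂ hΓ => ?_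
    rw [Multiset.forall_mem_cons] at h₁ h₂ hΓ
    exact hΓ.1.elim (fun h => h₁ ⟨h, hΓ.2⟩) (fun h => h₂ ⟨h, hΓ.2⟩)
  | orR₁ _ ih => exact Valid.of_imp hM ih fun ρ h hΓ => .inl (h hΓ)
  | orR₂ _ ih => exact Valid.of_imp hM ih fun ρ h hΓ => .inr (h hΓ)
  | allL t _ ih =>
    refine Valid.of_imp hM ih fun ρ h hΓ => ?_
    rw [Multiset.forall_mem_cons] at h hΓ
    exact h ⟨Form.true_subst_inst.2 (hΓ.1 _), hΓ.2⟩
  | allR ns _ hns _ ih => exact Valid.allR hM hns ih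
  | exL ns _ hns _ ih => exact Valid.exL hM hns ih
  | exR t _ ih => exact Valid.of_imp hM ih fun ρ h hΓ => ⟨_, Form.true_subst_inst.1 (h hΓ)⟩
  | nablaL k hk _ ih => exact Valid.nablaL hM hk ih
  | nablaR k hk _ ih => exact Valid.nablaR hM hk ih
  | contrL _ ih =>
    refine Valid.of_imp hM ih fun ρ h hΓ => ?_
    rw [Multiset.forall_mem_cons] at h
    exact h ⟨hΓ _ (by simp), hΓ⟩
  | weakL _ ih =>
    exact Valid.of_imp hM ih fun ρ h hΓ => h fun G hG => hΓ G (Multiset.mem_cons_of_mem hG)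
  | ax p ts π hπ => exact Valid.ax hM _ π hπ
  | mc cuts _ _ ih ih' => exact Valid.mc hM cuts ih ih'
  | defL p ts hp _ ih =>
    refine Valid.defL hD (fun us hus => ?_) ih
    rcases (model_iff_unfold hM').1 hus with ⟨_, h⟩ | ⟨B, h, _⟩
    · exact h
    · simp [hp] at h
  | defR c p ts B hc hB _ ih =>
    refine Valid.defR hM (fun us σ h₁ h₂ => (model_iff_unfold hM').2 (.inl ⟨?_, c, hc, σ, h₁, h₂⟩))
      hB ih
    simp only [Clause.head, Form.subst, Form.atom.injEq] at h₁
    cases hIp : I p with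
    | none => rfl
    | some B => exact ((hI p B hIp).2 c hc h₁.1).elim
  | indL p B J ts hp hJ _ _ ih₁ ih₂ =>
    refine Valid.indL hM (fun us => model_induction hlvl hIs hM' hp fun us hus => ?_) ih₂
    -- The invariant and the body have empty support, so the premise holds under every tuple `us`,
    -- whatever nominal constants it contains.
    refine ih₁ us ?_ fun G hG => ?_
    · refine Set.disjoint_right.2 ?_
      rintro n ⟨G, hG, hn⟩
      simp only [Multiset.mem_cons, Multiset.mem_singleton] at hG
      rcases hG with rfl | rfl
      · simp [hJ] at hn
      · simp [Form.supp_replacePred (hI p B hp).1 hJ] at hn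
    · rw [Multiset.mem_singleton.1 hG, Form.true_replacePred]
      exact hus
  | indR p B ts hp _ ih =>
    refine Valid.of_imp hM ih fun ρ h hΓ => (model_iff_unfold hM').2 (.inr ⟨B, hp, ?_⟩)
    exact Form.true_subst.1 (h hΓ)

end Soundness

end LD

/-- Consistency: for a valid set of definitions `D` and a valid set of inductive definitions `I` such
that, for one assignment of levels, `D` is weakly stratified and `I` is strictly stratified, the
sequent `⊢ ⊥` is not derivable. -/
theorem mainTheorem2 (S : LD.Signature.{u}) (D : Set (LD.Clause S)) (I : LD.IndDefs S)
    (hD : LD.ValidDefs D) (hI : LD.ValidInd D I)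
    (lvl : LD.Form S [] → Ordinal.{v}) (hlvl : LD.IsLevel lvl)
    (hDs : LD.WeaklyStratified lvl D) (hIs : LD.StrictlyStratified lvl I) :
    ¬ LD.Derivable D I [] 0 LD.Form.bot := by
  intro h
  obtain ⟨M, hM⟩ := LD.exists_model hlvl hDs hIs
  exact h.valid hD hI hlvl hIs (LD.model_perm hD hI hlvl hDs hIs hM) hM (LD.Sub.id [])
    (by simp [LD.Sub.supp_id]) (by simp)
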